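/- Let $n, r \ge 0$, let $H_1,\dots,H_r$ be hyperplanes in general position in complex projective space $\mathbb{P}^n$ (that is, $H_i$ is the zero locus of a linear form $\ell_i$ on $\mathbb{C}^{n+1}$, and any at most $n+1$ of the forms $\ell_1,\dots,\ell_r$ are linearly independent), and let $m_1,\dots,m_r\ge 1$ be integers. Let $(\mathbb{P}^n,b)$ be the orbifold with locus $\sum_i m_iH_i$, that is, $b:\mathbb{P}^n\to\mathbb{N}$ is the function $b(p)=\prod_{i:\,p\in H_i}m_i$. Let $\mathcal{L}$ be the set of all nonempty intersections of subfamilies of $\{H_1,\dots,H_r\}$ (including the empty intersection $\mathbb{P}^n$), and let $\mathcal{S}$ be the induced stratification of $\mathbb{P}^n$, whose strata are the sets $A\setminus\bigcup_{i:\,A\not\subseteq H_i}H_i$ for $A\in\mathcal{L}$. The function $b$ is constant on each stratum $S$; denote its value by $b(S)$. The orbifold Euler number is $$e_{orb}(\mathbb{P}^n,b):=\sum_{S\in\mathcal{S}}\frac{e(S)}{b(S)},$$ where $e(S)=\sum_k(-1)^k\dim_{\mathbb{Q}} H_k(S;\mathbb{Q})$ is the topological Euler number, defined by singular homology. Put $s_i:=1-1/m_i$.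 Then every stratum has finite-dimensional total rational homology (so that $e(S)$ is defined), and $$e_{orb}(\mathbb{P}^n,b)=\sum_{j=0}^n(-1)^j(n+1-j)\sum_{\substack{B\subseteq\{1,\dots,r\}\\ |B|=j}}\ \prod_{i\in B}s_i .$$ -/

import Mathlib

noncomputable section

namespace LinearOrbifold

/-! ### Euler numbers of topological spaces -/

/-- The singular chain complex of a space with rational coefficients. -/
abbrev singularChains (X : Type) [TopologicalSpace X] : ChainComplex (ModuleCat.{0} ℚ) ℕ :=
  ((AlgebraicTopology.singularChainComplexFunctor (ModuleCat.{0} ℚ)).obj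
    (ModuleCat.of ℚ ℚ)).obj (TopCat.of X)

/-- The singular homology of `X` with rational coefficients is finite dimensional in every degree
and vanishes in all but finitely many degrees; the Euler number of `X` is then meaningful. -/
def HasFiniteHomology (X : Type) [TopologicalSpace X] : Prop :=
  (∀ k : ℕ, Module.Finite ℚ ((singularChains X).homology k)) ∧
    {k : ℕ | ¬ Subsingleton ((singularChains X).homology k)}.Finite

/-- The Euler number `e(X) = ∑ₖ (-1)ᵏ dim H_k(X; ℚ)`. -/
def eulerNumber (X : Type) [TopologicalSpace X] : ℤ :=
  (singularChains X).homologyEulerChar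

/-! ### The orbifold Euler number of a stratified space with a `b`-function -/

/-- The value `b(S)` on `S` of a function `b` that is constant on the nonempty set `S`. -/
def valueOn {X : Type} (b : X → ℕ) (S : Set X) : ℕ := sInf (b '' S)

theorem valueOn_eq {X : Type} {b : X → ℕ} {S : Set X} {c : ℕ} (hS : S.Nonempty)
    (h : ∀ p ∈ S, b p = c) : valueOn b S = c := by
  have : b '' S = {c} := by
    ext x
    constructor
    · rintro ⟨p, hp, rfl⟩
      exact h p hp
    · rintro rfl
      obtain ⟨p, hp⟩ := hS
      exact ⟨p, hp, h p hp⟩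
  simp [valueOn, this]

/-- The orbifold Euler number `∑_{S ∈ 𝒮} e(S) / b(S)` of `(X, b)`, where `𝒮` is a finite
stratification of `X` whose strata are nonempty and such that `b` is constant on each of them. -/
def orbifoldEulerNumber {X : Type} [TopologicalSpace X] (𝒮 : Finset (Set X)) (b : X → ℕ) : ℚ :=
  ∑ S ∈ 𝒮, (eulerNumber S : ℚ) / (valueOn b S : ℚ)

/-! ### Hyperplane arrangements in complex projective space -/

/-- Complex projective `n`-space. -/
abbrev CP (n : ℕ) : Type := Projectivization ℂ (Fin (n + 1) → ℂ)

/-- Projective space carries the quotient topology of `ℂ^(n+1) ∖ {0}`. -/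
instance instTopologicalSpaceCP (n : ℕ) : TopologicalSpace (CP n) :=
  TopologicalSpace.coinduced
    (fun v : {v : Fin (n + 1) → ℂ // v ≠ 0} => Projectivization.mk' ℂ v) inferInstance

variable {n r : ℕ}

/-- The zero locus in `ℙⁿ` of a linear form; it is a hyperplane if the form is nonzero. -/
def hyperplane (l : Module.Dual ℂ (Fin (n + 1) → ℂ)) : Set (CP n) :=
  {p | ∀ v ∈ p.submodule, l v = 0}

/-- The hyperplanes defined by the forms `l i` are in general position: any at most `n + 1` of the
forms are linearly independent. So each form is nonzero, `k ≤ n` of the hyperplanes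
meet in codimension `k`, and `n + 1` of them have no common point. -/
def InGeneralPosition (l : Fin r → Module.Dual ℂ (Fin (n + 1) → ℂ)) : Prop :=
  ∀ B : Finset (Fin r), B.card ≤ n + 1 → LinearIndependent ℂ (fun i : B => l i)

open Classical in
/-- The intersection lattice: all nonempty intersections of members of the arrangement, including
the empty intersection `ℙⁿ`. -/
def intersectionLattice (l : Fin r → Module.Dual ℂ (Fin (n + 1) → ℂ)) : Finset (Set (CP n)) :=
  ((Finset.univ : Finset (Finset (Fin r))).image fun B => ⋂ i ∈ B, hyperplane (l i)).filter
    Set.Nonempty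

/-- The complement in `A` of the restriction to `A` of the arrangement, that is, the points of `A`
that lie on no hyperplane of the arrangement not containing `A`. -/
def stratum (l : Fin r → Module.Dual ℂ (Fin (n + 1) → ℂ)) (A : Set (CP n)) : Set (CP n) :=
  {p | p ∈ A ∧ ∀ i, p ∈ hyperplane (l i) → A ⊆ hyperplane (l i)}

open Classical in
/-- The stratification of `ℙⁿ` induced by the arrangement. -/
def stratification (l : Fin r → Module.Dual ℂ (Fin (n + 1) → ℂ)) : Finset (Set (CP n)) :=
  (intersectionLattice l).image (stratum l)

open Classical in
/-- The `b`-function `b(p) = ∏_{p ∈ H_i} m_i` of the orbifold with locus `∑ m_i H_i`. -/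
def bFunction (l : Fin r → Module.Dual ℂ (Fin (n + 1) → ℂ)) (m : Fin r → ℕ) (p : CP n) : ℕ :=
  ∏ i with p ∈ hyperplane (l i), m i

open Classical in
/-- The `b`-function is constant on the strata. -/
theorem bFunction_eq_of_mem_stratum (l : Fin r → Module.Dual ℂ (Fin (n + 1) → ℂ))
    (m : Fin r → ℕ) (A : Set (CP n)) (p : CP n) (hp : p ∈ stratum l A) :
    bFunction l m p = ∏ i with A ⊆ hyperplane (l i), m i := by
  unfold bFunction
  congr 1
  ext i
  simp only [Finset.mem_filter, Finset.mem_univ, true_and]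
  exact ⟨fun h => hp.2 i h, fun h => h hp.1⟩

end LinearOrbifold

end

/-!
Once the Euler number of each stratum is known, the sum over the strata is an inclusion-exclusion
over finite sets.

*Euler numbers.* Singular homology enters through three properties: homotopy invariance, the value
for a finite discrete space, and additivity on open covers `X = U ∪ V`, in the two forms
`HasEuler.union` (finiteness of `X` is a conclusion) and `HasEuler.of_union` (finiteness of `U` is a
conclusion). Additivity is excision: by iterated barycentric subdivision the chains that are small
with respect to an open cover have the homology of all chains
(`exists_sub_bd_mem_smallChains`, `subsingleton_homology_cokernel`), and the small chains form a
pushout of the chains on `U` and on `V` over those on `U ∩ V`. Subdivision is carried out on formal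
chains of tuples of points, where it is a recursion by cones, and transported to singular chains
along affine simplices.

*Strata.* Removing from a set the transverse section by a hyperplane subtracts the Euler number of
the section (`HasEuler.deletion`), because the section has a tubular neighbourhood that is a bundle
of discs, and the punctured discs have Euler number zero. By deletion and restriction, `s`
hyperplanes in general position in `ℂ^(d-1)` have a complement with Euler number
`∑_{j<d} (-1)^j C(s, j)` (`hasEuler_affineStratum`). If `B` is a set of at most `n` hyperplanes, the
points of `ℙⁿ` on precisely the hyperplanes in `B` form a stratum, and every stratum arises so from
a unique `B`. With a hyperplane outside `B` as hyperplane at infinity the stratum becomes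
the complement of an affine arrangement; if there is no such hyperplane, the stratum is a projective
subspace, whose Euler number is its dimension plus one (`hasEuler_projSubspace`). In both cases the
Euler number is `∑_{j<d} (-1)^j C(s, j) (d - j)` with `d = n + 1 - |B|` and `s = r - |B|`.

*Summation.* Here `C(s, j)` counts the sets `B' ⊇ B` with `|B'| = |B| + j`. Exchanging the sums over
`B` and `B'`, the sum over `B ⊆ B'` of `(-1)^|B' ∖ B| ∏_{i ∈ B} 1 / m i` is
`∏_{i ∈ B'} (1 / m i - 1)` (`sum_projEuler_mul_prod`).
-/

noncomputable section

namespace LinearOrbifold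

/-! ### Euler numbers of chain complexes -/

section

open CategoryTheory Limits

theorem finite_of_exact {M N P : Type*} [AddCommGroup M] [Module ℚ M] [AddCommGroup N]
    [Module ℚ N] [AddCommGroup P] [Module ℚ P] [Module.Finite ℚ M] [Module.Finite ℚ P]
    (f : M →ₗ[ℚ] N) (g : N →ₗ[ℚ] P) (h : Function.Exact f g) : Module.Finite ℚ N := by
  have := isNoetherian_of_range_eq_ker f g h.linearMap_ker_eq.symm
  infer_instance

theorem subsingleton_of_exact {M N P : Type*} [AddCommGroup M] [Module ℚ M] [AddCommGroup N]
    [Module ℚ N] [AddCommGroup P] [Module ℚ P] [Subsingleton M] [Subsingleton P]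
    (f : M →ₗ[ℚ] N) (g : N →ₗ[ℚ] P) (h : Function.Exact f g) : Subsingleton N := by
  refine subsingleton_of_forall_eq 0 fun x => ?_
  obtain ⟨y, rfl⟩ := (h x).1 (Subsingleton.elim _ _)
  rw [Subsingleton.elim y 0, map_zero]

section LongExact

variable {A B C : ℕ → Type} [∀ k, AddCommGroup (A k)] [∀ k, Module ℚ (A k)]
  [∀ k, AddCommGroup (B k)] [∀ k, Module ℚ (B k)] [∀ k, AddCommGroup (C k)] [∀ k, Module ℚ (C k)]

/-- In a long exact sequence `⋯ → Aₖ → Bₖ → Cₖ → Aₖ₋₁ → ⋯ → C₀ → 0` the alternating sum of the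
dimensions up to degree `N` is the rank of the next connecting map, up to sign. -/
theorem alternating_sum_of_exact [∀ k, Module.Finite ℚ (A k)] [∀ k, Module.Finite ℚ (B k)]
    [∀ k, Module.Finite ℚ (C k)]
    (f : ∀ k, A k →ₗ[ℚ] B k) (g : ∀ k, B k →ₗ[ℚ] C k) (δ : ∀ k, C (k + 1) →ₗ[ℚ] A k)
    (hA : ∀ k, Function.Exact (δ k) (f k)) (hB : ∀ k, Function.Exact (f k) (g k))
    (hC : ∀ k, Function.Exact (g (k + 1)) (δ k)) (h0 : Function.Surjective (g 0)) (N : ℕ) :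
    ∑ k ∈ Finset.range (N + 1), (-1 : ℤ) ^ k * Module.finrank ℚ (A k) +
      ∑ k ∈ Finset.range (N + 1), (-1 : ℤ) ^ k * Module.finrank ℚ (C k) =
      ∑ k ∈ Finset.range (N + 1), (-1 : ℤ) ^ k * Module.finrank ℚ (B k) +
        (-1) ^ N * Module.finrank ℚ (LinearMap.range (δ N)) := by
  have eA : ∀ k, Module.finrank ℚ (A k) = Module.finrank ℚ (LinearMap.range (f k)) +
      Module.finrank ℚ (LinearMap.range (δ k)) := fun k => by
    rw [← (hA k).linearMap_ker_eq, LinearMap.finrank_range_add_finrank_ker]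
  have eB : ∀ k, Module.finrank ℚ (B k) = Module.finrank ℚ (LinearMap.range (g k)) +
      Module.finrank ℚ (LinearMap.range (f k)) := fun k => by
    rw [← (hB k).linearMap_ker_eq, LinearMap.finrank_range_add_finrank_ker]
  have eC : ∀ k, Module.finrank ℚ (C (k + 1)) = Module.finrank ℚ (LinearMap.range (δ k)) +
      Module.finrank ℚ (LinearMap.range (g (k + 1))) := fun k => by
    rw [← (hC k).linearMap_ker_eq, LinearMap.finrank_range_add_finrank_ker]
  have eC0 : Module.finrank ℚ (C 0) = Module.finrank ℚ (LinearMap.range (g 0)) := by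
    rw [LinearMap.range_eq_top.2 h0, finrank_top]
  induction N with
  | zero => simp [eA, eB, eC0]; ring
  | succ N ih =>
    rw [Finset.sum_range_succ _ (N + 1), Finset.sum_range_succ _ (N + 1),
      Finset.sum_range_succ _ (N + 1), eA (N + 1), eB (N + 1), eC N]
    push_cast
    rw [pow_succ]
    linear_combination ih

end LongExact

/-- The total homology of the complex is finite dimensional, with Euler number `e`. -/
def HasEulerChar (K : ChainComplex (ModuleCat.{0} ℚ) ℕ) (e : ℤ) : Prop :=
  (∀ k, Module.Finite ℚ (K.homology k)) ∧
    {k : ℕ | ¬ Subsingleton (K.homology k)}.Finite ∧ K.homologyEulerChar = e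

theorem homologyEulerChar_eq_sum (K : ChainComplex (ModuleCat.{0} ℚ) ℕ) (N : ℕ)
    (h : ∀ k, N ≤ k → Subsingleton (K.homology k)) :
    K.homologyEulerChar = ∑ k ∈ Finset.range N, (-1 : ℤ) ^ k * Module.finrank ℚ (K.homology k) := by
  rw [HomologicalComplex.homologyEulerChar_eq_sum_finSet_of_finrankSupport_subset K
    (Finset.range N)]
  · refine Finset.sum_congr rfl fun k _ => ?_
    simp
  · rw [GradedObject.finrankSupport_subset_iff]
    intro k hk
    have := h k (by simpa using hk)
    exact Module.finrank_zero_of_subsingleton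

theorem HasEulerChar.of_iso_homology {K L : ChainComplex (ModuleCat.{0} ℚ) ℕ} {e : ℤ}
    (h : HasEulerChar K e) (i : ∀ k, Nonempty (K.homology k ≅ L.homology k)) :
    HasEulerChar L e := by
  have l : ∀ k, Nonempty (K.homology k ≃ₗ[ℚ] L.homology k) := fun k => ⟨(i k).some.toLinearEquiv⟩
  refine ⟨fun k => ?_, ?_, ?_⟩
  · have := h.1 k
    exact Module.Finite.equiv (l k).some
  · convert h.2.1 using 4 with k
    exact (l k).some.toEquiv.subsingleton_congr.symm
  · rw [← h.2.2]
    refine finsum_congr fun k => ?_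
    rw [(l k).some.finrank_eq]

theorem HasEulerChar.of_iso {K L : ChainComplex (ModuleCat.{0} ℚ) ℕ} {e : ℤ}
    (h : HasEulerChar K e) (i : K ≅ L) : HasEulerChar L e :=
  h.of_iso_homology fun k => ⟨(HomologicalComplex.homologyFunctor _ _ k).mapIso i⟩

theorem HasEulerChar.congr {K : ChainComplex (ModuleCat.{0} ℚ) ℕ} {e e' : ℤ}
    (h : HasEulerChar K e) (he : e = e') : HasEulerChar K e' := he ▸ h

theorem exact_homology₁ {S : ShortComplex (ChainComplex (ModuleCat.{0} ℚ) ℕ)}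
    (hS : S.ShortExact) (k : ℕ) :
    Function.Exact (hS.δ (k + 1) k rfl).hom (HomologicalComplex.homologyMap S.f k).hom :=
  (ShortComplex.ShortExact.moduleCat_exact_iff_function_exact _).1
    (hS.homology_exact₁ (k + 1) k rfl)

theorem exact_homology₂ {S : ShortComplex (ChainComplex (ModuleCat.{0} ℚ) ℕ)}
    (hS : S.ShortExact) (k : ℕ) :
    Function.Exact (HomologicalComplex.homologyMap S.f k).hom
      (HomologicalComplex.homologyMap S.g k).hom :=
  (ShortComplex.ShortExact.moduleCat_exact_iff_function_exact _).1 (hS.homology_exact₂ k)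

theorem exact_homology₃ {S : ShortComplex (ChainComplex (ModuleCat.{0} ℚ) ℕ)}
    (hS : S.ShortExact) (k : ℕ) :
    Function.Exact (HomologicalComplex.homologyMap S.g (k + 1)).hom (hS.δ (k + 1) k rfl).hom :=
  (ShortComplex.ShortExact.moduleCat_exact_iff_function_exact _).1
    (hS.homology_exact₃ (k + 1) k rfl)

theorem surjective_homology₀ {S : ShortComplex (ChainComplex (ModuleCat.{0} ℚ) ℕ)}
    (hS : S.ShortExact) : Function.Surjective (HomologicalComplex.homologyMap S.g 0).hom := by
  have := hS.epi_g
  exact (ModuleCat.epi_iff_surjective _).1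
    (HomologicalComplex.epi_homologyMap_of_epi_of_not_rel S.g 0 (by simp))

theorem homologyEulerChar_add {S : ShortComplex (ChainComplex (ModuleCat.{0} ℚ) ℕ)}
    (hS : S.ShortExact) (h₁ : ∀ k, Module.Finite ℚ (S.X₁.homology k))
    (h₂ : ∀ k, Module.Finite ℚ (S.X₂.homology k)) (h₃ : ∀ k, Module.Finite ℚ (S.X₃.homology k))
    (N : ℕ) (s₁ : ∀ k, N ≤ k → Subsingleton (S.X₁.homology k))
    (s₂ : ∀ k, N ≤ k → Subsingleton (S.X₂.homology k))
    (s₃ : ∀ k, N ≤ k → Subsingleton (S.X₃.homology k)) :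
    S.X₁.homologyEulerChar + S.X₃.homologyEulerChar = S.X₂.homologyEulerChar := by
  have hg := surjective_homology₀ hS
  have key := alternating_sum_of_exact
    (fun k => (HomologicalComplex.homologyMap S.f k).hom)
    (fun k => (HomologicalComplex.homologyMap S.g k).hom) (fun k => (hS.δ (k + 1) k rfl).hom)
    (exact_homology₁ hS) (exact_homology₂ hS) (exact_homology₃ hS) hg N
  have h0 : Module.finrank ℚ (LinearMap.range (hS.δ (N + 1) N rfl).hom) = 0 := by
    have := s₁ N le_rfl
    exact Module.finrank_zero_of_subsingleton
  rw [homologyEulerChar_eq_sum _ (N + 1) fun k hk => s₁ k (by omega),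
    homologyEulerChar_eq_sum _ (N + 1) fun k hk => s₂ k (by omega),
    homologyEulerChar_eq_sum _ (N + 1) fun k hk => s₃ k (by omega)]
  rw [h0] at key
  simpa using key

theorem HasEulerChar.exists_bound {K : ChainComplex (ModuleCat.{0} ℚ) ℕ} {e : ℤ}
    (h : HasEulerChar K e) : ∃ N, ∀ k, N ≤ k → Subsingleton (K.homology k) := by
  obtain ⟨N, hN⟩ := h.2.1.bddAbove
  refine ⟨N + 1, fun k hk => ?_⟩
  by_contra hc
  have := hN hc
  omega

theorem hasEulerChar_of_bound {K : ChainComplex (ModuleCat.{0} ℚ) ℕ} {e : ℤ} (N : ℕ)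
    (hf : ∀ k, Module.Finite ℚ (K.homology k))
    (hN : ∀ k, N ≤ k → Subsingleton (K.homology k)) (he : K.homologyEulerChar = e) :
    HasEulerChar K e := by
  refine ⟨hf, (Set.finite_lt_nat N).subset fun k hk => ?_, he⟩
  by_contra hc
  exact hk (hN k (not_lt.1 hc))

theorem HasEulerChar.shortExact₃ {S : ShortComplex (ChainComplex (ModuleCat.{0} ℚ) ℕ)}
    (hS : S.ShortExact) {a b : ℤ} (h₁ : HasEulerChar S.X₁ a) (h₂ : HasEulerChar S.X₂ b) :
    HasEulerChar S.X₃ (b - a) := by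
  obtain ⟨N₁, s₁⟩ := h₁.exists_bound
  obtain ⟨N₂, s₂⟩ := h₂.exists_bound
  have f₁ := h₁.1
  have f₂ := h₂.1
  have hg := surjective_homology₀ hS
  have f₃ : ∀ k, Module.Finite ℚ (S.X₃.homology k)
    | 0 => Module.Finite.of_surjective _ hg
    | k + 1 => finite_of_exact _ _ (exact_homology₃ hS k)
  have s₃ : ∀ k, N₁ + N₂ + 1 ≤ k → Subsingleton (S.X₃.homology k)
    | 0, h => by omega
    | k + 1, h => by
      have := s₁ k (by omega)
      have := s₂ (k + 1) (by omega)
      exact subsingleton_of_exact _ _ (exact_homology₃ hS k)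
  refine hasEulerChar_of_bound _ f₃ s₃ ?_
  have := homologyEulerChar_add hS f₁ f₂ f₃ (N₁ + N₂ + 1) (fun k hk => s₁ k (by omega))
    (fun k hk => s₂ k (by omega)) s₃
  rw [h₁.2.2, h₂.2.2] at this
  omega

theorem HasEulerChar.shortExact₂ {S : ShortComplex (ChainComplex (ModuleCat.{0} ℚ) ℕ)}
    (hS : S.ShortExact) {a c : ℤ} (h₁ : HasEulerChar S.X₁ a) (h₃ : HasEulerChar S.X₃ c) :
    HasEulerChar S.X₂ (a + c) := by
  obtain ⟨N₁, s₁⟩ := h₁.exists_bound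
  obtain ⟨N₃, s₃⟩ := h₃.exists_bound
  have f₁ := h₁.1
  have f₃ := h₃.1
  have f₂ : ∀ k, Module.Finite ℚ (S.X₂.homology k) := fun k =>
    finite_of_exact _ _ (exact_homology₂ hS k)
  have s₂ : ∀ k, N₁ + N₃ ≤ k → Subsingleton (S.X₂.homology k) := fun k h => by
    have := s₁ k (by omega)
    have := s₃ k (by omega)
    exact subsingleton_of_exact _ _ (exact_homology₂ hS k)
  refine hasEulerChar_of_bound _ f₂ s₂ ?_
  have := homologyEulerChar_add hS f₁ f₂ f₃ (N₁ + N₃) (fun k hk => s₁ k (by omega))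
    s₂ (fun k hk => s₃ k (by omega))
  rw [h₁.2.2, h₃.2.2] at this
  omega

/-- A monomorphism of complexes whose cokernel is acyclic does not change the Euler number. -/
theorem HasEulerChar.of_exact_cokernel {S : ShortComplex (ChainComplex (ModuleCat.{0} ℚ) ℕ)}
    (hS : S.ShortExact) (h : ∀ k, Subsingleton (S.X₃.homology k)) {e : ℤ} :
    HasEulerChar S.X₁ e ↔ HasEulerChar S.X₂ e := by
  have : ∀ k, IsIso (HomologicalComplex.homologyMap S.f k) := fun k => by
    refine (ConcreteCategory.isIso_iff_bijective _).2 ⟨?_, fun y => ?_⟩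
    · refine (injective_iff_map_eq_zero _).2 fun x hx => ?_
      obtain ⟨y, rfl⟩ := (exact_homology₁ hS k x).1 hx
      have := h (k + 1)
      rw [Subsingleton.elim y 0, map_zero]
    · exact (exact_homology₂ hS k y).1 ((h k).elim _ _)
  exact ⟨fun h => h.of_iso_homology fun k => ⟨asIso (HomologicalComplex.homologyMap S.f k)⟩,
    fun h => h.of_iso_homology fun k => ⟨(asIso (HomologicalComplex.homologyMap S.f k)).symm⟩⟩

/-- If `X₁ → X₂` and `X₃ → X₄` are parallel monomorphisms in a pushout square of complexes, they
have the same cokernel. -/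
theorem exists_cokernel_of_isPushout {X₁ X₂ X₃ X₄ : ChainComplex (ModuleCat.{0} ℚ) ℕ}
    {t : X₁ ⟶ X₂} {l : X₁ ⟶ X₃} {r : X₂ ⟶ X₄} {b : X₃ ⟶ X₄} (h : IsPushout t l r b)
    [Mono t] [Mono b] :
    ∃ (Q : ChainComplex (ModuleCat.{0} ℚ) ℕ) (p : X₂ ⟶ Q) (q : X₄ ⟶ Q) (hp : t ≫ p = 0)
      (hq : b ≫ q = 0), (ShortComplex.mk t p hp).ShortExact ∧
        (ShortComplex.mk b q hq).ShortExact := by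
  have hw : t ≫ cokernel.π t = l ≫ 0 := by simp
  have hb : b ≫ h.desc (cokernel.π t) 0 hw = 0 := h.inr_desc _ _ _
  have hr : r ≫ h.desc (cokernel.π t) 0 hw = cokernel.π t := h.inl_desc _ _ _
  have : Epi (h.desc (cokernel.π t) 0 hw) := by
    have : Epi (r ≫ h.desc (cokernel.π t) 0 hw) := by rw [hr]; infer_instance
    exact epi_of_epi r _
  refine ⟨cokernel t, cokernel.π t, h.desc (cokernel.π t) 0 hw, cokernel.condition t, hb, ?_, ?_⟩
  · exact { exact := ShortComplex.exact_cokernel t }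
  · refine { exact := ShortComplex.exact_of_g_is_cokernel _ ?_ }
    refine CokernelCofork.IsColimit.ofπ' _ _ fun {T} k hk => ?_
    have hk' : t ≫ r ≫ k = 0 := by rw [← Category.assoc, h.w, Category.assoc, hk, comp_zero]
    refine ⟨cokernel.desc t (r ≫ k) hk', h.hom_ext ?_ ?_⟩
    · rw [← Category.assoc, hr, cokernel.π_desc]
    · rw [← Category.assoc, hb, zero_comp, hk]

end

/-! ### Free chains on simplicial sets -/

section

open CategoryTheory Limits Simplicial

/-- The copower `∐_{t ∈ T} ℚ`, by which singular chains are defined, is the free vector space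
on `T`, since both are left adjoint to the forgetful functor. -/
def freeIso : (sigmaConst.obj (ModuleCat.of ℚ ℚ) : Type ⥤ ModuleCat.{0} ℚ) ≅ ModuleCat.free ℚ :=
  (sigmaConstAdj (ModuleCat.of ℚ ℚ)).leftAdjointUniq
    ((ModuleCat.adj ℚ).ofNatIsoRight (NatIso.ofComponents
      (fun M => Equiv.toIso ((ModuleCat.homEquiv (M := ModuleCat.of ℚ ℚ) (N := M)).trans
        (LinearMap.ringLmapEquivSelf ℚ ℚ M).toEquiv).symm)
      fun {M N} f => by
        ext x
        apply ModuleCat.hom_ext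
        apply LinearMap.ext_ring
        change (1 : ℚ) • f.hom x = f.hom ((1 : ℚ) • x)
        simp))

/-- The unnormalized rational chains of a simplicial set, as finitely supported functions on
simplices. -/
def freeChains : SSet.{0} ⥤ ChainComplex (ModuleCat.{0} ℚ) ℕ :=
  (SimplicialObject.whiskering _ _).obj (ModuleCat.free ℚ) ⋙
    AlgebraicTopology.alternatingFaceMapComplex (ModuleCat.{0} ℚ)

/-- Chains defined by copowers are the same as finitely supported functions. -/
def freeChainsIso (S : SSet.{0}) : S.chainComplex (ModuleCat.of ℚ ℚ) ≅ freeChains.obj S :=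
  (AlgebraicTopology.alternatingFaceMapComplex _).mapIso
    (((SimplicialObject.whiskering _ _).mapIso freeIso).app S)

theorem isPushout_freeChains {S₁ S₂ S₃ S₄ : SSet.{0}} {t : S₁ ⟶ S₂} {l : S₁ ⟶ S₃} {r : S₂ ⟶ S₄}
    {b : S₃ ⟶ S₄} (h : IsPushout t l r b) :
    IsPushout (freeChains.map t) (freeChains.map l) (freeChains.map r) (freeChains.map b) := by
  refine ⟨⟨by rw [← Functor.map_comp, h.w, Functor.map_comp]⟩,
    ⟨HomologicalComplex.isColimitOfEval _ _ fun n => ?_⟩⟩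
  refine (PushoutCocone.isColimitMapCoconeEquiv _ _).2 ?_
  have := (ModuleCat.adj ℚ).leftAdjoint_preservesColimits
  exact ((h.map ((evaluation _ _).obj (Opposite.op ⦋n⦌))).map (ModuleCat.free ℚ)).isColimit

theorem alternating_sum_hom_apply {M N : ModuleCat.{0} ℚ} {n : ℕ} (f : Fin n → (M ⟶ N))
    (x : M) :
    (∑ i : Fin n, (-1 : ℤ) ^ (i : ℕ) • f i).hom x =
      ∑ i : Fin n, (-1 : ℚ) ^ (i : ℕ) • (f i).hom x := by
  rw [ModuleCat.hom_sum, LinearMap.sum_apply]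
  refine Finset.sum_congr rfl fun i _ => ?_
  rw [← Int.cast_smul_eq_zsmul ℚ]
  push_cast
  rfl

theorem freeChains_d (S : SSet.{0}) (n : ℕ) (x : S _⦋n + 1⦌ →₀ ℚ) :
    ((freeChains.obj S).d (n + 1) n).hom x =
      ∑ i : Fin (n + 2), (-1 : ℚ) ^ (i : ℕ) • Finsupp.mapDomain (S.δ i) x := by
  have h : (freeChains.obj S).d (n + 1) n = ∑ i : Fin (n + 2), (-1 : ℤ) ^ (i : ℕ) •
      (ModuleCat.free ℚ).map (S.δ i) := by
    simp only [freeChains, Functor.comp_obj, AlgebraicTopology.alternatingFaceMapComplex_obj_d,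
      AlgebraicTopology.AlternatingFaceMapComplex.objD]
    rfl
  exact (congrArg (fun f => f.hom x) h).trans (alternating_sum_hom_apply
    (M := (ModuleCat.free ℚ).obj (S _⦋n + 1⦌)) (fun i => (ModuleCat.free ℚ).map (S.δ i)) x)

end

/-! ### Barycentric subdivision of chains of ordered tuples -/

section TupleChains

variable {P Q : Type*}

/-- Formal rational combinations of `m`-tuples of points; an `m`-tuple stands for an ordered simplex
of dimension `m - 1`, so that the complex is augmented by the empty tuple. -/
abbrev TupleChain (P : Type*) (m : ℕ) : Type _ := (Fin m → P) →₀ ℚ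

/-- The boundary: the alternating sum of the tuples with one entry removed. -/
def tupleBd (P : Type*) (m : ℕ) : TupleChain P (m + 1) →ₗ[ℚ] TupleChain P m :=
  ∑ i : Fin (m + 1), (-1 : ℚ) ^ (i : ℕ) • Finsupp.lmapDomain ℚ ℚ fun w => w ∘ i.succAbove

/-- The cone with apex `b`. -/
def tupleCone {m : ℕ} (b : P) : TupleChain P m →ₗ[ℚ] TupleChain P (m + 1) :=
  Finsupp.lmapDomain ℚ ℚ fun w => (Fin.cons b w : Fin (m + 1) → P)

/-- The map on chains induced by a map of points. -/
def tupleMap (f : P → Q) (m : ℕ) : TupleChain P m →ₗ[ℚ] TupleChain Q m :=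
  Finsupp.lmapDomain ℚ ℚ fun w => f ∘ w

@[simp] theorem tupleCone_single {m : ℕ} (b : P) (w : Fin m → P) (q : ℚ) :
    tupleCone b (Finsupp.single w q) = Finsupp.single (Fin.cons b w : Fin (m + 1) → P) q := by
  simp [tupleCone]

@[simp] theorem tupleMap_single {m : ℕ} (f : P → Q) (w : Fin m → P) (q : ℚ) :
    tupleMap f m (Finsupp.single w q) = Finsupp.single (f ∘ w) q := by
  simp [tupleMap]

theorem tupleBd_single {m : ℕ} (w : Fin (m + 1) → P) :
    tupleBd P m (Finsupp.single w 1) =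
      ∑ i : Fin (m + 1), (-1 : ℚ) ^ (i : ℕ) • Finsupp.single (w ∘ i.succAbove) 1 := by
  simp [tupleBd, LinearMap.sum_apply]

theorem tupleBd_cone_zero (b : P) (c : TupleChain P 0) : tupleBd P 0 (tupleCone b c) = c := by
  induction c using Finsupp.induction_linear with
  | zero => simp
  | add x y hx hy => rw [map_add, map_add, hx, hy]
  | single w q =>
    rw [tupleCone_single, tupleBd, LinearMap.sum_apply, Fin.sum_univ_one, LinearMap.smul_apply,
      Finsupp.lmapDomain_apply, Finsupp.mapDomain_single, Fin.val_zero, pow_zero, one_smul,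
      Subsingleton.elim ((Fin.cons b w : Fin 1 → P) ∘ _) w]

theorem tupleBd_cone {m : ℕ} (b : P) (c : TupleChain P (m + 1)) :
    tupleBd P (m + 1) (tupleCone b c) = c - tupleCone b (tupleBd P m c) := by
  induction c using Finsupp.induction_linear with
  | zero => simp
  | add x y hx hy => simp only [map_add, hx, hy]; abel
  | single w q =>
    simp only [tupleBd, tupleCone_single, LinearMap.sum_apply, map_sum,
      LinearMap.smul_apply, Finsupp.lmapDomain_apply, Finsupp.mapDomain_single, map_smul]
    rw [Fin.sum_univ_succ]
    have h0 : (Fin.cons b w : Fin (m + 2) → P) ∘ (0 : Fin (m + 2)).succAbove = w := by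
      ext i; simp
    have h1 : ∀ i : Fin (m + 1), (Fin.cons b w : Fin (m + 2) → P) ∘ i.succ.succAbove =
        Fin.cons b (w ∘ i.succAbove) := fun i => by
      ext j
      refine Fin.cases ?_ (fun j => ?_) j <;> simp
    simp only [h0, h1, Fin.val_zero, pow_zero, one_smul, Fin.val_succ, pow_succ, mul_neg, mul_one,
      neg_smul, Finset.sum_neg_distrib, sub_eq_add_neg]

theorem tupleBd_comp (m : ℕ) (c : TupleChain P (m + 2)) :
    tupleBd P m (tupleBd P (m + 1) c) = 0 := by
  induction m with
  | zero =>
    induction c using Finsupp.induction_linear with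
    | zero => simp
    | add x y hx hy => simp only [map_add, hx, hy, add_zero]
    | single w q =>
      rw [← Fin.cons_self_tail w, ← tupleCone_single, tupleBd_cone, map_sub, tupleBd_cone_zero,
        sub_self]
  | succ m ih =>
    induction c using Finsupp.induction_linear with
    | zero => simp
    | add x y hx hy => simp only [map_add, hx, hy, add_zero]
    | single w q =>
      rw [← Fin.cons_self_tail w, ← tupleCone_single, tupleBd_cone, map_sub, tupleBd_cone, ih,
        map_zero, sub_zero, sub_self]

theorem tupleMap_cone {m : ℕ} (f : P → Q) (b : P) (c : TupleChain P m) :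
    tupleMap f (m + 1) (tupleCone b c) = tupleCone (f b) (tupleMap f m c) := by
  induction c using Finsupp.induction_linear with
  | zero => simp
  | add x y hx hy => simp only [map_add, hx, hy]
  | single w q => simp [Fin.comp_cons]

theorem tupleMap_bd {m : ℕ} (f : P → Q) (c : TupleChain P (m + 1)) :
    tupleMap f m (tupleBd P m c) = tupleBd Q m (tupleMap f (m + 1) c) := by
  simp only [tupleMap, tupleBd, LinearMap.sum_apply, map_sum, LinearMap.smul_apply, map_smul,
    Finsupp.lmapDomain_apply, ← Finsupp.mapDomain_comp]
  rfl

variable (β : ∀ m : ℕ, (Fin (m + 1) → P) → P) (γ : ∀ m : ℕ, (Fin (m + 1) → Q) → Q)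

/-- The subdivision operator: the cone from the chosen centre `β w` of a tuple `w` on the
subdivision of its boundary. -/
def tupleSd : ∀ m : ℕ, TupleChain P m →ₗ[ℚ] TupleChain P m
  | 0 => LinearMap.id
  | m + 1 => Finsupp.linearCombination ℚ fun w =>
      tupleCone (β m w) (tupleSd m (tupleBd P m (Finsupp.single w 1)))

/-- The chain homotopy between the identity and the subdivision operator. -/
def tupleHtpy : ∀ m : ℕ, TupleChain P m →ₗ[ℚ] TupleChain P (m + 1)
  | 0 => 0
  | m + 1 => Finsupp.linearCombination ℚ fun w =>
      tupleCone (β m w)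
        (Finsupp.single w 1 - tupleHtpy m (tupleBd P m (Finsupp.single w 1)))

theorem tupleSd_single (m : ℕ) (w : Fin (m + 1) → P) :
    tupleSd β (m + 1) (Finsupp.single w 1) =
      tupleCone (β m w) (tupleSd β m (tupleBd P m (Finsupp.single w 1))) := by
  rw [tupleSd, Finsupp.linearCombination_single, one_smul]

theorem tupleHtpy_single (m : ℕ) (w : Fin (m + 1) → P) :
    tupleHtpy β (m + 1) (Finsupp.single w 1) = tupleCone (β m w)
      (Finsupp.single w 1 - tupleHtpy β m (tupleBd P m (Finsupp.single w 1))) := by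
  rw [tupleHtpy, Finsupp.linearCombination_single, one_smul]

theorem tupleSd_bd (m : ℕ) (c : TupleChain P (m + 1)) :
    tupleBd P m (tupleSd β (m + 1) c) = tupleSd β m (tupleBd P m c) := by
  induction m with
  | zero =>
    refine LinearMap.congr_fun (f := tupleBd P 0 ∘ₗ tupleSd β 1) (g := tupleSd β 0 ∘ₗ tupleBd P 0)
      (Finsupp.lhom_ext' fun w => LinearMap.ext_ring ?_) c
    simp only [LinearMap.comp_apply, Finsupp.lsingle_apply, tupleSd_single, tupleBd_cone_zero]
  | succ m ih =>
    refine LinearMap.congr_fun (f := tupleBd P (m + 1) ∘ₗ tupleSd β (m + 2))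
      (g := tupleSd β (m + 1) ∘ₗ tupleBd P (m + 1))
      (Finsupp.lhom_ext' fun w => LinearMap.ext_ring ?_) c
    simp only [LinearMap.comp_apply, Finsupp.lsingle_apply, tupleSd_single, tupleBd_cone, ih,
      tupleBd_comp, map_zero, sub_zero]

theorem tupleHtpy_bd (m : ℕ) (c : TupleChain P (m + 1)) :
    tupleBd P (m + 1) (tupleHtpy β (m + 1) c) =
      c - tupleSd β (m + 1) c - tupleHtpy β m (tupleBd P m c) := by
  induction m with
  | zero =>
    refine LinearMap.congr_fun (f := tupleBd P 1 ∘ₗ tupleHtpy β 1)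
      (g := LinearMap.id - tupleSd β 1 - tupleHtpy β 0 ∘ₗ tupleBd P 0)
      (Finsupp.lhom_ext' fun w => LinearMap.ext_ring ?_) c
    simp only [LinearMap.comp_apply, LinearMap.sub_apply, LinearMap.id_apply,
      Finsupp.lsingle_apply, tupleSd_single, tupleHtpy_single, tupleBd_cone]
    simp [tupleHtpy, tupleSd]
  | succ m ih =>
    refine LinearMap.congr_fun (f := tupleBd P (m + 2) ∘ₗ tupleHtpy β (m + 2))
      (g := LinearMap.id - tupleSd β (m + 2) - tupleHtpy β (m + 1) ∘ₗ tupleBd P (m + 1))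
      (Finsupp.lhom_ext' fun w => LinearMap.ext_ring ?_) c
    simp only [LinearMap.comp_apply, LinearMap.sub_apply, LinearMap.id_apply,
      Finsupp.lsingle_apply, tupleSd_single, tupleHtpy_single, tupleBd_cone, map_sub, ih,
      tupleBd_comp, map_zero, sub_zero]
    abel

variable {β γ}

theorem tupleMap_sd {f : P → Q} (hf : ∀ m w, f (β m w) = γ m (f ∘ w)) (m : ℕ)
    (c : TupleChain P m) : tupleMap f m (tupleSd β m c) = tupleSd γ m (tupleMap f m c) := by
  induction m with
  | zero => rfl
  | succ m ih =>
    refine LinearMap.congr_fun (f := tupleMap f (m + 1) ∘ₗ tupleSd β (m + 1))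
      (g := tupleSd γ (m + 1) ∘ₗ tupleMap f (m + 1))
      (Finsupp.lhom_ext' fun w => LinearMap.ext_ring ?_) c
    simp only [LinearMap.comp_apply, Finsupp.lsingle_apply, tupleSd_single, tupleMap_single,
      tupleMap_cone, ih, tupleMap_bd, hf]

theorem tupleMap_htpy {f : P → Q} (hf : ∀ m w, f (β m w) = γ m (f ∘ w)) (m : ℕ)
    (c : TupleChain P m) :
    tupleMap f (m + 1) (tupleHtpy β m c) = tupleHtpy γ m (tupleMap f m c) := by
  induction m with
  | zero => simp [tupleHtpy]
  | succ m ih =>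
    refine LinearMap.congr_fun (f := tupleMap f (m + 2) ∘ₗ tupleHtpy β (m + 1))
      (g := tupleHtpy γ (m + 1) ∘ₗ tupleMap f (m + 1))
      (Finsupp.lhom_ext' fun w => LinearMap.ext_ring ?_) c
    simp only [LinearMap.comp_apply, Finsupp.lsingle_apply, tupleHtpy_single, tupleMap_single,
      tupleMap_cone, map_sub, ih, tupleMap_bd, hf]

end TupleChains

section Mesh

variable {P : Type*} [PseudoMetricSpace P] (β : ∀ m : ℕ, (Fin (m + 1) → P) → P)

/-- Tuples whose points are pairwise at distance at most `D` and, whenever a closed ball contains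
the points of `v`, lie in this ball. -/
def meshSet {k : ℕ} (v : Fin k → P) (m : ℕ) (D : ℝ) : Set (Fin m → P) :=
  {w | (∀ i j, dist (w i) (w j) ≤ D) ∧
    ∀ q R, (∀ i, dist q (v i) ≤ R) → ∀ j, dist q (w j) ≤ R}

theorem self_mem_meshSet {k : ℕ} (v : Fin k → P) {D : ℝ} (h : ∀ i j, dist (v i) (v j) ≤ D) :
    v ∈ meshSet v k D := ⟨h, fun _ _ h => h⟩

theorem meshSet_subset {k m : ℕ} {v : Fin k → P} {w : Fin m → P}
    (h : ∀ q R, (∀ i, dist q (v i) ≤ R) → ∀ j, dist q (w j) ≤ R) (l : ℕ) (D : ℝ) :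
    meshSet w l D ⊆ meshSet v l D :=
  fun _ hu => ⟨hu.1, fun q R hq => hu.2 q R (h q R hq)⟩

theorem map_mem_supported {α M : Type*} [AddCommGroup M] [Module ℚ M]
    (f : (α →₀ ℚ) →ₗ[ℚ] M) {s : Set α} {t : Submodule ℚ M}
    (h : ∀ a ∈ s, f (Finsupp.single a 1) ∈ t) {c : α →₀ ℚ} (hc : c ∈ Finsupp.supported ℚ ℚ s) :
    f c ∈ t := by
  rw [Finsupp.supported_eq_span_single] at hc
  have : Submodule.span ℚ ((fun i => Finsupp.single i (1 : ℚ)) '' s) ≤ t.comap f := by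
    rw [Submodule.span_le]
    rintro _ ⟨a, ha, rfl⟩
    exact h a ha
  exact this hc

variable {β} {ρ : ℝ} {N : ℕ}

/-- One subdivision shrinks the mesh of a tuple by the factor `ρ`, if the centres `β w` of tuples of
diameter at most `D` have distance at most `ρ * D` from all the entries. -/
theorem tupleSd_mem_meshSet (hρ : 0 ≤ ρ)
    (h₁ : ∀ m w q R, (∀ i, dist q (w i) ≤ R) → dist q (β m w) ≤ R)
    (h₂ : ∀ m w D, m ≤ N → (∀ i j, dist (w i) (w j) ≤ D) → ∀ i, dist (β m w) (w i) ≤ ρ * D)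
    (m : ℕ) (hm : m ≤ N + 1) (v : Fin m → P) (D : ℝ) (hv : ∀ i j, dist (v i) (v j) ≤ D) :
    tupleSd β m (Finsupp.single v 1) ∈ Finsupp.supported ℚ ℚ (meshSet v m (ρ * D)) := by
  induction m with
  | zero =>
    exact Finsupp.single_mem_supported _ _ ⟨fun i => i.elim0, fun _ _ h => h⟩
  | succ m ih =>
    have hD : 0 ≤ D := dist_nonneg.trans (hv 0 0)
    rw [tupleSd_single]
    refine map_mem_supported (s := meshSet v m (ρ * D)) _ (fun w hw => ?_) ?_
    · rw [tupleCone_single]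
      refine Finsupp.single_mem_supported _ _ ⟨fun i j => ?_, fun q R hq j => ?_⟩
      · have hb : ∀ j, dist (β m v) (w j) ≤ ρ * D := hw.2 _ _ (h₂ m v D (by omega) hv)
        refine Fin.cases ?_ (fun i => ?_) i <;> refine Fin.cases ?_ (fun j => ?_) j
        · simpa using mul_nonneg hρ hD
        · simpa using hb j
        · simpa [dist_comm] using hb i
        · simpa using hw.1 i j
      · refine Fin.cases ?_ (fun j => ?_) j
        · simpa using h₁ m v q R hq
        · simpa using hw.2 q R hq j
    · rw [tupleBd_single, map_sum]
      refine Submodule.sum_mem _ fun i _ => ?_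
      rw [map_smul]
      refine Submodule.smul_mem _ _ (Finsupp.supported_mono
        (meshSet_subset (fun q R hq j => ?_) m _)
        (ih (by omega) (v ∘ i.succAbove) fun _ _ => hv _ _))
      exact hq _

theorem tupleSd_iterate_mem_meshSet (hρ : 0 ≤ ρ)
    (h₁ : ∀ m w q R, (∀ i, dist q (w i) ≤ R) → dist q (β m w) ≤ R)
    (h₂ : ∀ m w D, m ≤ N → (∀ i j, dist (w i) (w j) ≤ D) → ∀ i, dist (β m w) (w i) ≤ ρ * D)
    (m : ℕ) (hm : m ≤ N + 1) (v : Fin m → P) (D : ℝ) (hv : ∀ i j, dist (v i) (v j) ≤ D) (k : ℕ) :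
    (tupleSd β m)^[k] (Finsupp.single v 1) ∈
      Finsupp.supported ℚ ℚ (meshSet v m (ρ ^ k * D)) := by
  induction k with
  | zero => exact Finsupp.single_mem_supported _ _ (by simpa using self_mem_meshSet v hv)
  | succ k ih =>
    rw [Function.iterate_succ_apply']
    refine map_mem_supported _ (fun w hw => ?_) ih
    have := tupleSd_mem_meshSet hρ h₁ h₂ m hm w _ hw.1
    rw [pow_succ', mul_assoc]
    exact Finsupp.supported_mono (meshSet_subset hw.2 m _) this

end Mesh

/-! ### Small singular simplices -/

/-- The standard topological simplex of dimension `n`. -/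
abbrev Simplex (n : ℕ) : Type := stdSimplex ℝ (Fin (n + 1))

/-- The affine map `Δⁿ → Δᴺ` with prescribed values at the vertices. -/
def affineSimplex {n N : ℕ} (w : Fin (n + 1) → Simplex N) : C(Simplex n, Simplex N) where
  toFun t := ⟨∑ i, t i • (w i).1,
    (convex_stdSimplex ℝ _).sum_mem (fun i _ => t.2.1 i) t.2.2 fun i _ => (w i).2⟩
  continuous_toFun := by
    refine Continuous.subtype_mk (continuous_finsetSum _ fun i _ => ?_) _
    exact ((continuous_apply i).comp continuous_subtype_val).smul continuous_const

theorem affineSimplex_coe {n N : ℕ} (w : Fin (n + 1) → Simplex N) (t : Simplex n) :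
    (affineSimplex w t).1 = ∑ i, t i • (w i).1 := rfl

theorem affineSimplex_map {n m N : ℕ} (w : Fin (n + 1) → Simplex N) (f : Fin (m + 1) → Fin (n + 1))
    (t : Simplex m) : affineSimplex w (stdSimplex.map f t) = affineSimplex (w ∘ f) t := by
  refine Subtype.ext ?_
  rw [affineSimplex_coe, affineSimplex_coe]
  have : ∀ j, (stdSimplex.map f t) j = ∑ i with f i = j, t i := fun j => by
    rw [stdSimplex.map_coe, FunOnFinite.linearMap_apply_apply]
  simp only [this, Finset.sum_smul, Finset.sum_filter]
  rw [Finset.sum_comm]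
  simp

theorem affineSimplex_vertex {n N : ℕ} (w : Fin (n + 1) → Simplex N) (i : Fin (n + 1)) :
    affineSimplex w (stdSimplex.vertex i) = w i := by
  refine Subtype.ext ?_
  rw [affineSimplex_coe]
  simp [Pi.single_apply]

theorem affineSimplex_id {n : ℕ} (t : Simplex n) :
    affineSimplex (fun i => stdSimplex.vertex i) t = t := by
  refine Subtype.ext ?_
  rw [affineSimplex_coe]
  ext j
  simp [Pi.single_apply]
  rfl

theorem affineSimplex_comp {n m N : ℕ} (w : Fin (n + 1) → Simplex N) (u : Fin (m + 1) → Simplex n)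
    (t : Simplex m) :
    affineSimplex w (affineSimplex u t) = affineSimplex (affineSimplex w ∘ u) t := by
  refine Subtype.ext ?_
  rw [affineSimplex_coe, affineSimplex_coe]
  simp only [Function.comp, affineSimplex_coe]
  have : ∀ i, (affineSimplex u t) i = ∑ j, t j * u j i := fun i => by
    refine (congrFun (affineSimplex_coe u t) i).trans ?_
    rw [Finset.sum_apply]
    rfl
  simp only [this, Finset.sum_smul, Finset.smul_sum]
  rw [Finset.sum_comm]
  simp only [smul_smul]

/-- The barycentre of a tuple of points of a simplex. -/
def center (N : ℕ) (m : ℕ) (w : Fin (m + 1) → Simplex N) : Simplex N :=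
  affineSimplex w (stdSimplex.barycenter)

theorem affineSimplex_center {n N : ℕ} (w : Fin (n + 1) → Simplex N) (m : ℕ)
    (u : Fin (m + 1) → Simplex n) :
    affineSimplex w (center n m u) = center N m (affineSimplex w ∘ u) :=
  affineSimplex_comp _ _ _

theorem dist_affineSimplex_le {n N : ℕ} (w : Fin (n + 1) → Simplex N) (t : Simplex n)
    (q : Simplex N) (R : ℝ) (h : ∀ i, dist q (w i) ≤ R) : dist q (affineSimplex w t) ≤ R := by
  have := (convex_closedBall q.1 R).sum_mem (t := Finset.univ)
    (w := fun i => t i) (z := fun i => (w i).1) (fun i _ => t.2.1 i) t.2.2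
    fun i _ => by
      rw [Metric.mem_closedBall, dist_comm]
      exact h i
  rw [dist_comm]
  exact this

theorem dist_center_le {N : ℕ} (m : ℕ) (w : Fin (m + 1) → Simplex N) (D : ℝ) (hm : m ≤ N)
    (h : ∀ i j, dist (w i) (w j) ≤ D) (i : Fin (m + 1)) :
    dist (center N m w) (w i) ≤ (N / (N + 1) : ℝ) * D := by
  have hD : 0 ≤ D := dist_nonneg.trans (h 0 0)
  have e : (center N m w).1 - (w i).1 =
      ∑ j, ((m + 1 : ℝ)⁻¹) • ((w j).1 - (w i).1) := by
    rw [center, affineSimplex_coe]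
    have hb : ∀ j, (stdSimplex.barycenter : Simplex m) j = (m + 1 : ℝ)⁻¹ := fun j => by
      refine (stdSimplex.barycenter_apply j).trans ?_
      simp
    have h1 : ∑ _j : Fin (m + 1), (m + 1 : ℝ)⁻¹ • (w i).1 = (w i).1 := by
      rw [← Finset.sum_smul, Finset.sum_const, Finset.card_univ, Fintype.card_fin, nsmul_eq_mul,
        Nat.cast_succ, mul_inv_cancel₀ (by positivity), one_smul]
    simp only [hb, smul_sub, Finset.sum_sub_distrib, h1]
  have hn : dist (center N m w) (w i) = ‖(center N m w).1 - (w i).1‖ := by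
    rw [← dist_eq_norm]; rfl
  rw [hn, e]
  calc _ ≤ ∑ j, ‖((m + 1 : ℝ)⁻¹) • ((w j).1 - (w i).1)‖ := norm_sum_le _ _
    _ ≤ ∑ j, if j = i then 0 else (m + 1 : ℝ)⁻¹ * D := by
        refine Finset.sum_le_sum fun j _ => ?_
        split_ifs with hj
        · simp [hj]
        · rw [norm_smul, Real.norm_of_nonneg (by positivity)]
          refine mul_le_mul_of_nonneg_left ?_ (by positivity)
          have := h j i
          rwa [← dist_eq_norm]
    _ = m / (m + 1) * D := by
        rw [Finset.sum_ite, Finset.sum_const_zero, zero_add, Finset.sum_const,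
          Finset.filter_ne' Finset.univ i, Finset.card_erase_of_mem (Finset.mem_univ i)]
        simp
        ring
    _ ≤ _ := by
        refine mul_le_mul_of_nonneg_right ?_ hD
        have : (m : ℝ) ≤ N := by exact_mod_cast hm
        rw [div_le_div_iff₀ (by positivity) (by positivity)]
        nlinarith

section Singular

variable {X : Type*} [TopologicalSpace X]

/-- Rational singular chains of dimension `n`. -/
abbrev SingChain (X : Type*) [TopologicalSpace X] (n : ℕ) : Type _ := C(Simplex n, X) →₀ ℚ

/-- The inclusion of the `i`-th face of the standard simplex. -/
def faceMap (n : ℕ) (i : Fin (n + 2)) : C(Simplex n, Simplex (n + 1)) :=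
  ⟨stdSimplex.map i.succAbove, stdSimplex.continuous_map _⟩

/-- The singular boundary. -/
def singBd (X : Type*) [TopologicalSpace X] (n : ℕ) : SingChain X (n + 1) →ₗ[ℚ] SingChain X n :=
  ∑ i : Fin (n + 2), (-1 : ℚ) ^ (i : ℕ) • Finsupp.lmapDomain ℚ ℚ fun σ => σ.comp (faceMap n i)

/-- The chains obtained by restricting the singular simplex `σ` to affine simplices. -/
def restrictChain {N : ℕ} (σ : C(Simplex N, X)) (n : ℕ) :
    TupleChain (Simplex N) (n + 1) →ₗ[ℚ] SingChain X n :=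
  Finsupp.lmapDomain ℚ ℚ fun w => σ.comp (affineSimplex w)

@[simp] theorem restrictChain_single {N : ℕ} (σ : C(Simplex N, X)) (n : ℕ)
    (w : Fin (n + 1) → Simplex N) (q : ℚ) :
    restrictChain σ n (Finsupp.single w q) = Finsupp.single (σ.comp (affineSimplex w)) q := by
  simp [restrictChain]

theorem restrictChain_bd {N : ℕ} (σ : C(Simplex N, X)) (n : ℕ)
    (c : TupleChain (Simplex N) (n + 2)) :
    singBd X n (restrictChain σ (n + 1) c) = restrictChain σ n (tupleBd _ (n + 1) c) := by
  have : ∀ (i : Fin (n + 2)) (w : Fin (n + 2) → Simplex N),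
      (σ.comp (affineSimplex w)).comp (faceMap n i) = σ.comp (affineSimplex (w ∘ i.succAbove)) :=
    fun i w => ContinuousMap.ext fun t => congrArg σ (affineSimplex_map _ _ _)
  simp only [restrictChain, singBd, tupleBd, LinearMap.sum_apply, map_sum, LinearMap.smul_apply,
    map_smul, Finsupp.lmapDomain_apply, ← Finsupp.mapDomain_comp]
  refine Finset.sum_congr rfl fun i _ => ?_
  congr 2
  exact funext (this i)

theorem restrictChain_affine {n N : ℕ} (σ : C(Simplex N, X)) (w : Fin (n + 1) → Simplex N) (m : ℕ)
    (c : TupleChain (Simplex n) (m + 1)) :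
    restrictChain (σ.comp (affineSimplex w)) m c =
      restrictChain σ m (tupleMap (affineSimplex w) (m + 1) c) := by
  simp only [restrictChain, tupleMap, Finsupp.lmapDomain_apply, ← Finsupp.mapDomain_comp]
  congr 1
  funext u
  exact ContinuousMap.ext fun t => congrArg σ (affineSimplex_comp _ _ _)

/-- The ordered vertices of the standard simplex. -/
def vertices (n : ℕ) : Fin (n + 1) → Simplex n := fun i => stdSimplex.vertex i

theorem restrictChain_vertices {N : ℕ} (σ : C(Simplex N, X)) :
    restrictChain σ N (Finsupp.single (vertices N) 1) = Finsupp.single σ 1 := by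
  rw [restrictChain_single]
  congr 1
  exact ContinuousMap.ext fun t => congrArg σ (affineSimplex_id t)

theorem affineSimplex_comp_vertices {n N : ℕ} (w : Fin (n + 1) → Simplex N) :
    affineSimplex w ∘ vertices n = w := funext fun i => affineSimplex_vertex w i

/-- Barycentric subdivision of singular chains. -/
def singSd (X : Type*) [TopologicalSpace X] (n : ℕ) : SingChain X n →ₗ[ℚ] SingChain X n :=
  Finsupp.linearCombination ℚ fun σ =>
    restrictChain σ n (tupleSd (center n) (n + 1) (Finsupp.single (vertices n) 1))

/-- The chain homotopy between the identity and barycentric subdivision. -/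
def singHtpy (X : Type*) [TopologicalSpace X] (n : ℕ) : SingChain X n →ₗ[ℚ] SingChain X (n + 1) :=
  Finsupp.linearCombination ℚ fun σ =>
    restrictChain σ (n + 1) (tupleHtpy (center n) (n + 1) (Finsupp.single (vertices n) 1))

theorem singSd_restrictChain {N : ℕ} (σ : C(Simplex N, X)) (n : ℕ)
    (c : TupleChain (Simplex N) (n + 1)) :
    singSd X n (restrictChain σ n c) = restrictChain σ n (tupleSd (center N) (n + 1) c) := by
  refine LinearMap.congr_fun (f := singSd X n ∘ₗ restrictChain σ n)
    (g := restrictChain σ n ∘ₗ tupleSd (center N) (n + 1))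
    (Finsupp.lhom_ext' fun w => LinearMap.ext_ring ?_) c
  simp only [LinearMap.comp_apply, Finsupp.lsingle_apply, restrictChain_single]
  rw [singSd, Finsupp.linearCombination_single, one_smul, restrictChain_affine,
    tupleMap_sd (affineSimplex_center w), tupleMap_single, affineSimplex_comp_vertices]

theorem singHtpy_restrictChain {N : ℕ} (σ : C(Simplex N, X)) (n : ℕ)
    (c : TupleChain (Simplex N) (n + 1)) :
    singHtpy X n (restrictChain σ n c) =
      restrictChain σ (n + 1) (tupleHtpy (center N) (n + 1) c) := by
  refine LinearMap.congr_fun (f := singHtpy X n ∘ₗ restrictChain σ n)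
    (g := restrictChain σ (n + 1) ∘ₗ tupleHtpy (center N) (n + 1))
    (Finsupp.lhom_ext' fun w => LinearMap.ext_ring ?_) c
  simp only [LinearMap.comp_apply, Finsupp.lsingle_apply, restrictChain_single]
  rw [singHtpy, Finsupp.linearCombination_single, one_smul, restrictChain_affine,
    tupleMap_htpy (affineSimplex_center w), tupleMap_single, affineSimplex_comp_vertices]

theorem singSd_bd (n : ℕ) (c : SingChain X (n + 1)) :
    singBd X n (singSd X (n + 1) c) = singSd X n (singBd X n c) := by
  refine LinearMap.congr_fun (f := singBd X n ∘ₗ singSd X (n + 1))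
    (g := singSd X n ∘ₗ singBd X n) (Finsupp.lhom_ext' fun σ => LinearMap.ext_ring ?_) c
  simp only [LinearMap.comp_apply, Finsupp.lsingle_apply]
  rw [← restrictChain_vertices σ, singSd_restrictChain, restrictChain_bd, restrictChain_bd,
    singSd_restrictChain, tupleSd_bd]

theorem singHtpy_bd (n : ℕ) (c : SingChain X (n + 1)) :
    singBd X (n + 1) (singHtpy X (n + 1) c) =
      c - singSd X (n + 1) c - singHtpy X n (singBd X n c) := by
  refine LinearMap.congr_fun (f := singBd X (n + 1) ∘ₗ singHtpy X (n + 1))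
    (g := LinearMap.id - singSd X (n + 1) - singHtpy X n ∘ₗ singBd X n)
    (Finsupp.lhom_ext' fun σ => LinearMap.ext_ring ?_) c
  simp only [LinearMap.comp_apply, LinearMap.sub_apply, LinearMap.id_apply, Finsupp.lsingle_apply]
  rw [← restrictChain_vertices σ, singSd_restrictChain, restrictChain_bd, singHtpy_restrictChain,
    singHtpy_restrictChain, restrictChain_bd, tupleHtpy_bd, map_sub, map_sub]

/-- Singular simplices with image in one of two given sets. -/
def smallSimplices (U V : Set X) (n : ℕ) : Set C(Simplex n, X) :=
  {σ | (∀ t, σ t ∈ U) ∨ ∀ t, σ t ∈ V}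

/-- Singular chains composed of simplices with image in one of two given sets. -/
abbrev smallChains (U V : Set X) (n : ℕ) : Submodule ℚ (SingChain X n) :=
  Finsupp.supported ℚ ℚ (smallSimplices U V n)

theorem restrictChain_mem_smallChains {U V : Set X} {N : ℕ} {σ : C(Simplex N, X)}
    (hσ : σ ∈ smallSimplices U V N) (n : ℕ) (c : TupleChain (Simplex N) (n + 1)) :
    restrictChain σ n c ∈ smallChains U V n := by
  refine map_mem_supported (s := Set.univ) _ (fun w _ => ?_) (by simp)
  rw [restrictChain_single]
  exact Finsupp.single_mem_supported _ _ (hσ.imp (fun h t => h _) fun h t => h _)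

theorem singSd_mem_smallChains {U V : Set X} {n : ℕ} {c : SingChain X n}
    (hc : c ∈ smallChains U V n) : singSd X n c ∈ smallChains U V n := by
  refine map_mem_supported _ (fun σ hσ => ?_) hc
  rw [singSd, Finsupp.linearCombination_single, one_smul]
  exact restrictChain_mem_smallChains hσ _ _

theorem singHtpy_mem_smallChains {U V : Set X} {n : ℕ} {c : SingChain X n}
    (hc : c ∈ smallChains U V n) : singHtpy X n c ∈ smallChains U V (n + 1) := by
  refine map_mem_supported _ (fun σ hσ => ?_) hc
  rw [singHtpy, Finsupp.linearCombination_single, one_smul]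
  exact restrictChain_mem_smallChains hσ _ _

/-- By the Lebesgue number lemma, iterated subdivision makes every singular simplex small. -/
theorem exists_iterate_singSd_single {U V : Set X} (hU : IsOpen U) (hV : IsOpen V)
    (hUV : U ∪ V = Set.univ) {n : ℕ} (σ : C(Simplex n, X)) :
    ∃ k, (singSd X n)^[k] (Finsupp.single σ 1) ∈ smallChains U V n := by
  have e : ∀ k, (singSd X n)^[k] (Finsupp.single σ 1) = restrictChain σ n
      ((tupleSd (center n) (n + 1))^[k] (Finsupp.single (vertices n) 1)) := fun k => by
    induction k with
    | zero => exact (restrictChain_vertices σ).symm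
    | succ k ih => rw [Function.iterate_succ_apply', ih, singSd_restrictChain,
        Function.iterate_succ_apply']
  obtain ⟨δ, hδ, hδ'⟩ := lebesgue_number_lemma_of_metric (s := (Set.univ : Set (Simplex n)))
    (c := fun b : Bool => σ ⁻¹' (if b then U else V)) isCompact_univ
    (fun b => by cases b <;> simp [hU.preimage σ.continuous, hV.preimage σ.continuous])
    (fun t _ => by
      have : σ t ∈ U ∪ V := hUV ▸ Set.mem_univ _
      rcases this with h | h
      · exact Set.mem_iUnion.2 ⟨true, by simpa using h⟩
      · exact Set.mem_iUnion.2 ⟨false, by simpa using h⟩)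
  obtain ⟨D, hD⟩ : ∃ D, ∀ i j, dist (vertices n i) (vertices n j) ≤ D := by
    obtain ⟨D, hD⟩ := Metric.isBounded_iff.1 (Set.finite_range (vertices n)).isBounded
    exact ⟨D, fun i j => hD ⟨i, rfl⟩ ⟨j, rfl⟩⟩
  have hρ : (0 : ℝ) ≤ n / (n + 1) := by positivity
  have hρ' : (n / (n + 1) : ℝ) < 1 := by rw [div_lt_one (by positivity)]; linarith
  obtain ⟨k, hk⟩ : ∃ k : ℕ, (n / (n + 1) : ℝ) ^ k * D < δ := by
    have := (tendsto_pow_atTop_nhds_zero_of_lt_one hρ hρ').mul_const D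
    rw [zero_mul] at this
    exact (this.eventually (gt_mem_nhds hδ)).exists
  refine ⟨k, ?_⟩
  rw [e]
  refine map_mem_supported _ (fun w hw => ?_) (tupleSd_iterate_mem_meshSet hρ
    (fun m w q R h => dist_affineSimplex_le w _ q R h) dist_center_le (n + 1) le_rfl _ D hD k)
  rw [restrictChain_single]
  refine Finsupp.single_mem_supported _ _ ?_
  obtain ⟨b, hb⟩ := hδ' (w 0) (Set.mem_univ _)
  have hw' : ∀ t, affineSimplex w t ∈ σ ⁻¹' (if b then U else V) := fun t => hb (by
    rw [Metric.mem_ball, dist_comm]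
    exact (dist_affineSimplex_le w t (w 0) _ fun i => hw.1 0 i).trans_lt hk)
  cases b
  · exact Or.inr fun t => by simpa using hw' t
  · exact Or.inl fun t => by simpa using hw' t

theorem iterate_singSd_mem_smallChains {U V : Set X} {n : ℕ} {c : SingChain X n}
    (hc : c ∈ smallChains U V n) (k : ℕ) : (singSd X n)^[k] c ∈ smallChains U V n := by
  induction k with
  | zero => exact hc
  | succ k ih => rw [Function.iterate_succ_apply']; exact singSd_mem_smallChains ih

theorem exists_iterate_singSd {U V : Set X} (hU : IsOpen U) (hV : IsOpen V)
    (hUV : U ∪ V = Set.univ) {n : ℕ} (c : SingChain X n) :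
    ∃ k, (singSd X n)^[k] c ∈ smallChains U V n := by
  simp only [← Module.End.coe_pow]
  induction c using Finsupp.induction_linear with
  | zero => exact ⟨0, by simp⟩
  | add x y hx hy =>
    obtain ⟨k, hk⟩ := hx
    obtain ⟨l, hl⟩ := hy
    refine ⟨k + l, ?_⟩
    rw [map_add]
    refine Submodule.add_mem _ ?_ ?_
    · rw [add_comm k l, pow_add, Module.End.mul_apply, Module.End.coe_pow]
      exact iterate_singSd_mem_smallChains hk l
    · rw [pow_add, Module.End.mul_apply, Module.End.coe_pow]
      exact iterate_singSd_mem_smallChains hl k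
  | single σ q =>
    obtain ⟨k, hk⟩ := exists_iterate_singSd_single hU hV hUV σ
    refine ⟨k, ?_⟩
    rw [← mul_one q, ← smul_eq_mul, ← Finsupp.smul_single, map_smul]
    exact Submodule.smul_mem _ _ (by simpa only [Module.End.coe_pow] using hk)

/-- The theorem on small simplices: a chain whose boundary is small is small up to a boundary. -/
theorem exists_sub_bd_mem_smallChains {U V : Set X} (hU : IsOpen U) (hV : IsOpen V)
    (hUV : U ∪ V = Set.univ) (n : ℕ) (c : SingChain X (n + 1))
    (hc : singBd X n c ∈ smallChains U V n) :
    ∃ y, c - singBd X (n + 1) y ∈ smallChains U V (n + 1) := by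
  obtain ⟨k, hk⟩ := exists_iterate_singSd hU hV hUV c
  induction k generalizing c with
  | zero => exact ⟨0, by simpa using hk⟩
  | succ k ih =>
    obtain ⟨y, hy⟩ := ih (singSd X (n + 1) c)
      (by rw [singSd_bd]; exact singSd_mem_smallChains hc) hk
    refine ⟨y + singHtpy X (n + 1) c, ?_⟩
    rw [map_add, singHtpy_bd]
    have : c - (singBd X (n + 1) y + (c - singSd X (n + 1) c - singHtpy X n (singBd X n c))) =
        (singSd X (n + 1) c - singBd X (n + 1) y) + singHtpy X n (singBd X n c) := by abel
    rw [this]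
    exact Submodule.add_mem _ hy (singHtpy_mem_smallChains hc)

end Singular

/-! ### Chains subordinate to an open cover -/

section

open CategoryTheory Limits Simplicial

variable {X : Type} [TopologicalSpace X]

/-- The singular simplices of `X` with image in `A`, as a simplicial subset. -/
def singIn (A : Set X) : (TopCat.toSSet.obj (TopCat.of X)).Subcomplex where
  obj n := {σ | ∀ t, TopCat.toSSetObjEquiv _ n σ t ∈ A}
  map f _ hσ t := hσ (stdSimplex.map f.unop t)

/-- Singular simplices of the subspace `A` are the singular simplices of `X` with image in `A`. -/
def singInIso (A : Set X) : TopCat.toSSet.obj (TopCat.of A) ≅ (singIn A : SSet.{0}) :=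
  NatIso.ofComponents (fun n => Equiv.toIso
    { toFun := fun σ => ⟨(TopCat.toSSetObjEquiv (TopCat.of X) n).symm
        ((ContinuousMap.mk Subtype.val continuous_subtype_val).comp
          (TopCat.toSSetObjEquiv (TopCat.of A) n σ)),
          fun t => (TopCat.toSSetObjEquiv (TopCat.of A) n σ t).2⟩
      invFun := fun σ => (TopCat.toSSetObjEquiv (TopCat.of A) n).symm
        ⟨fun t => ⟨TopCat.toSSetObjEquiv _ n σ.1 t, σ.2 t⟩,
          (TopCat.toSSetObjEquiv _ n σ.1).continuous.subtype_mk _⟩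
      left_inv := fun _ => rfl
      right_inv := fun _ => rfl }) (fun _ => rfl)

/-- Singular simplices as continuous maps on the standard simplex. -/
def singEquiv (X : Type) [TopologicalSpace X] (n : ℕ) :
    (TopCat.toSSet.obj (TopCat.of X)) _⦋n⦌ ≃ C(Simplex n, X) :=
  TopCat.toSSetObjEquiv (TopCat.of X) (Opposite.op ⦋n⦌)

theorem singIn_inf (A B : Set X) : singIn A ⊓ singIn B = singIn (A ∩ B) := by
  ext n σ
  exact ⟨fun h t => ⟨h.1 t, h.2 t⟩, fun h => ⟨fun t => (h t).1, fun t => (h t).2⟩⟩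

/-- Singular chains of `X` in terms of maps from standard simplices. -/
def singChainEquiv (X : Type) [TopologicalSpace X] (n : ℕ) :
    ((TopCat.toSSet.obj (TopCat.of X)) _⦋n⦌ →₀ ℚ) ≃ₗ[ℚ] SingChain X n :=
  Finsupp.domLCongr (singEquiv X n)

theorem singChainEquiv_d (n : ℕ) (x : (TopCat.toSSet.obj (TopCat.of X)) _⦋n + 1⦌ →₀ ℚ) :
    singChainEquiv X n (((freeChains.obj (TopCat.toSSet.obj (TopCat.of X))).d (n + 1) n).hom x) =
      singBd X n (singChainEquiv X (n + 1) x) := by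
  rw [freeChains_d, map_sum, singBd, LinearMap.sum_apply]
  refine Finset.sum_congr rfl fun i _ => ?_
  rw [map_smul, LinearMap.smul_apply]
  congr 1
  simp only [singChainEquiv, Finsupp.domLCongr_apply, Finsupp.lmapDomain_apply,
    Finsupp.domCongr_apply, Finsupp.equivMapDomain_eq_mapDomain, ← Finsupp.mapDomain_comp]
  rfl

/-- A chain comes from a simplicial subset if and only if it is supported on it. -/
theorem mem_range_freeChains_ι {S : SSet.{0}} (A : S.Subcomplex) (n : ℕ) (x : S _⦋n⦌ →₀ ℚ) :
    (∃ y, ((freeChains.map A.ι).f n).hom y = x) ↔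
      x ∈ Finsupp.supported ℚ ℚ (A.obj (Opposite.op ⦋n⦌)) := by
  constructor
  · rintro ⟨y, rfl⟩
    refine map_mem_supported (s := Set.univ) ((freeChains.map A.ι).f n).hom (fun a _ => ?_)
      (c := y)
      (by rw [Finsupp.supported_univ]; exact Submodule.mem_top)
    refine (congrArg (· ∈ _) (Finsupp.mapDomain_single)).mpr ?_
    exact Finsupp.single_mem_supported _ _ a.2
  · intro hx
    have : ∃ y, Finsupp.mapDomain (Subtype.val : A.obj (Opposite.op ⦋n⦌) → _) y = x := by
      refine ⟨Finsupp.comapDomain Subtype.val x Subtype.val_injective.injOn, ?_⟩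
      refine Finsupp.mapDomain_comapDomain _ Subtype.val_injective _ ?_
      intro a ha
      exact ⟨⟨a, hx ha⟩, rfl⟩
    exact this

theorem mono_freeChains_of_injective {S T : SSet.{0}} (f : S ⟶ T)
    (h : ∀ n, Function.Injective (f.app (Opposite.op ⦋n⦌))) : Mono (freeChains.map f) := by
  have : ∀ n, Mono ((freeChains.map f).f n) := fun n =>
    (ModuleCat.mono_iff_injective _).2 (Finsupp.mapDomain_injective (h n))
  exact HomologicalComplex.mono_of_mono_f _ this

instance {S : SSet.{0}} (A : S.Subcomplex) : Mono (freeChains.map A.ι) :=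
  mono_freeChains_of_injective _ fun _ => Subtype.val_injective

instance {S : SSet.{0}} {A B : S.Subcomplex} (h : A ≤ B) :
    Mono (freeChains.map (SSet.Subcomplex.homOfLE h)) :=
  mono_freeChains_of_injective _ fun _ _ _ hab =>
    Subtype.ext (congrArg (fun c => (c : B.obj _).1) hab)

/-- The chains on an open cover have the same homology as all chains. -/
theorem subsingleton_homology_cokernel {U V : Set X} (hU : IsOpen U) (hV : IsOpen V)
    (hUV : U ∪ V = Set.univ) (n : ℕ) :
    Subsingleton ((cokernel (freeChains.map (singIn U ⊔ singIn V).ι)).homology n) := by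
  set S := TopCat.toSSet.obj (TopCat.of X)
  set i := freeChains.map (singIn U ⊔ singIn V).ι
  have hS : (ShortComplex.mk i (cokernel.π i) (cokernel.condition i)).ShortExact :=
    { exact := ShortComplex.exact_cokernel i }
  have hn := fun k => (HomologicalComplex.shortExact_iff_degreewise_shortExact _).1 hS k
  have hs : ∀ k, Function.Surjective ((cokernel.π i).f k).hom := fun k =>
    (hn k).moduleCat_surjective_g
  have he : ∀ k, Function.Exact (i.f k).hom ((cokernel.π i).f k).hom := fun k =>
    (ShortComplex.ShortExact.moduleCat_exact_iff_function_exact _).1 (hn k).exact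
  have small : ∀ k (x : S _⦋k⦌ →₀ ℚ), ((cokernel.π i).f k).hom x = 0 ↔
      singChainEquiv X k x ∈ smallChains U V k := fun k x => by
    refine (he k x).trans ((mem_range_freeChains_ι _ _ _).trans ?_)
    have h1 : smallSimplices U V k =
        (singEquiv X k).symm ⁻¹' ((singIn U ⊔ singIn V).obj (Opposite.op ⦋k⦌)) := rfl
    rw [smallChains, Finsupp.mem_supported, Finsupp.mem_supported, h1, singChainEquiv,
      Finsupp.domLCongr_apply]
    constructor
    · intro h a ha
      exact h (by simpa using ha)
    · intro h a ha
      have := @h (singEquiv X k a) (by simpa using ha)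
      simpa using this
  refine ModuleCat.subsingleton_of_isZero
    ((HomologicalComplex.exactAt_iff_isZero_homology _ _).1 ?_)
  cases n with
  | zero =>
    rw [HomologicalComplex.exactAt_iff' _ 1 0 0 (by simp) (by simp),
      ShortComplex.moduleCat_exact_iff]
    intro q _
    obtain ⟨x, rfl⟩ := hs 0 q
    refine ⟨0, (map_zero _).trans ((small 0 x).2 fun σ _ => ?_).symm⟩
    have : σ default ∈ U ∪ V := hUV ▸ Set.mem_univ _
    exact this.imp (fun h t => by rwa [Subsingleton.elim t default])
      fun h t => by rwa [Subsingleton.elim t default]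
  | succ n =>
    rw [HomologicalComplex.exactAt_iff' _ (n + 2) (n + 1) n (by simp) (by simp),
      ShortComplex.moduleCat_exact_iff]
    intro q hq
    obtain ⟨x, rfl⟩ := hs (n + 1) q
    have comm : ∀ k (z : S _⦋k + 1⦌ →₀ ℚ),
        ((cokernel i).d (k + 1) k).hom (((cokernel.π i).f (k + 1)).hom z) =
        ((cokernel.π i).f k).hom (((freeChains.obj S).d (k + 1) k).hom z) := fun k z => by
      have := (cokernel.π i).comm (k + 1) k
      exact congrArg (fun f => f.hom z) this
    have hx : singBd X n (singChainEquiv X (n + 1) x) ∈ smallChains U V n :=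
      (congrArg (· ∈ smallChains U V n) (singChainEquiv_d n x)).mp
        ((small n _).1 ((comm n x).symm.trans hq))
    obtain ⟨y, hy⟩ := exists_sub_bd_mem_smallChains hU hV hUV n _ hx
    obtain ⟨y, rfl⟩ := (singChainEquiv X (n + 2)).surjective y
    have e := (congrArg (singChainEquiv X (n + 1) x - ·) (singChainEquiv_d (n + 1) y)).symm.trans
      (map_sub (singChainEquiv X (n + 1)) _ _).symm
    refine ⟨((cokernel.π i).f (n + 2)).hom y, ?_⟩
    have h0 := (small (n + 1) _).2 ((congrArg (· ∈ smallChains U V (n + 1)) e).mp hy)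
    refine (comm (n + 1) y).trans ?_
    exact (sub_eq_zero.1 ((map_sub ((cokernel.π i).f (n + 1)).hom _ _).symm.trans h0)).symm

end

/-! ### Additivity and homotopy invariance of the Euler number -/

section

open CategoryTheory Limits Simplicial

/-- The total singular homology of `X` is finite dimensional, and `X` has Euler number `e`. -/
def HasEuler (X : Type) [TopologicalSpace X] (e : ℤ) : Prop :=
  HasEulerChar (singularChains X) e

variable {X Y : Type} [TopologicalSpace X] [TopologicalSpace Y] {e : ℤ}

theorem HasEuler.hasFiniteHomology (h : HasEuler X e) : HasFiniteHomology X := ⟨h.1, h.2.1⟩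

theorem HasEuler.eulerNumber_eq (h : HasEuler X e) : eulerNumber X = e := h.2.2

theorem HasEuler.congr {e' : ℤ} (h : HasEuler X e) (he : e = e') : HasEuler X e' := he ▸ h

theorem hasEuler_iff_freeChains :
    HasEuler X e ↔ HasEulerChar (freeChains.obj (TopCat.toSSet.obj (TopCat.of X))) e :=
  ⟨fun h => HasEulerChar.of_iso h (freeChainsIso _),
    fun h => HasEulerChar.of_iso h (freeChainsIso _).symm⟩

theorem hasEuler_iff_singIn {A : Set X} :
    HasEuler A e ↔ HasEulerChar (freeChains.obj (singIn A : SSet.{0})) e :=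
  hasEuler_iff_freeChains.trans ⟨fun h => h.of_iso (freeChains.mapIso (singInIso A)),
    fun h => h.of_iso (freeChains.mapIso (singInIso A)).symm⟩

theorem hasEuler_iff_sup {U V : Set X} (hU : IsOpen U) (hV : IsOpen V)
    (hUV : U ∪ V = Set.univ) :
    HasEuler X e ↔ HasEulerChar (freeChains.obj (singIn U ⊔ singIn V).toSSet) e := by
  have hS : (ShortComplex.mk _ _
      (cokernel.condition (freeChains.map (singIn U ⊔ singIn V).ι))).ShortExact :=
    { exact := ShortComplex.exact_cokernel _ }
  exact hasEuler_iff_freeChains.trans (HasEulerChar.of_exact_cokernel hS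
    (subsingleton_homology_cokernel hU hV hUV)).symm

/-- The inclusions of the chains on `U ∩ V` into those on `U`, and of the chains on `V` into the
small chains, have a common cokernel. -/
theorem exists_cokernel_openCover (U V : Set X) :
    ∃ (Q : ChainComplex (ModuleCat.{0} ℚ) ℕ)
      (t : freeChains.obj (singIn (U ∩ V)).toSSet ⟶ freeChains.obj (singIn U).toSSet)
      (b : freeChains.obj (singIn V).toSSet ⟶ freeChains.obj (singIn U ⊔ singIn V).toSSet)
      (p : freeChains.obj (singIn U).toSSet ⟶ Q)
      (q : freeChains.obj (singIn U ⊔ singIn V).toSSet ⟶ Q) (hp : t ≫ p = 0)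
      (hq : b ≫ q = 0), (ShortComplex.mk t p hp).ShortExact ∧
        (ShortComplex.mk b q hq).ShortExact := by
  have sq : SSet.Subcomplex.BicartSq (singIn (U ∩ V)) (singIn U) (singIn V)
      (singIn U ⊔ singIn V) := { sup_eq := rfl, inf_eq := singIn_inf U V }
  obtain ⟨Q, p, q, hp, hq, h₁, h₂⟩ :=
    exists_cokernel_of_isPushout (isPushout_freeChains sq.isPushout)
  exact ⟨Q, _, _, p, q, hp, hq, h₁, h₂⟩

/-- Additivity of the Euler number on an open cover, with finiteness of the union as a
conclusion. -/
theorem HasEuler.union {U V : Set X} (hU : IsOpen U) (hV : IsOpen V) (hUV : U ∪ V = Set.univ)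
    {u v w : ℤ} (hu : HasEuler U u) (hv : HasEuler V v) (hw : HasEuler (U ∩ V : Set X) w) :
    HasEuler X (u + v - w) := by
  obtain ⟨Q, t, b, p, q, hp, hq, h₁, h₂⟩ := exists_cokernel_openCover U V
  have hQ : HasEulerChar Q (u - w) :=
    HasEulerChar.shortExact₃ h₁ (hasEuler_iff_singIn.1 hw) (hasEuler_iff_singIn.1 hu)
  exact (hasEuler_iff_sup hU hV hUV).2
    ((HasEulerChar.shortExact₂ h₂ (hasEuler_iff_singIn.1 hv) hQ).congr (by ring))

/-- Additivity of the Euler number on an open cover, with finiteness of one of the open sets as a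
conclusion. -/
theorem HasEuler.of_union {U V : Set X} (hU : IsOpen U) (hV : IsOpen V) (hUV : U ∪ V = Set.univ)
    {x v w : ℤ} (hx : HasEuler X x) (hv : HasEuler V v) (hw : HasEuler (U ∩ V : Set X) w) :
    HasEuler U (x + w - v) := by
  obtain ⟨Q, t, b, p, q, hp, hq, h₁, h₂⟩ := exists_cokernel_openCover U V
  have hQ : HasEulerChar Q (x - v) := HasEulerChar.shortExact₃ h₂ (hasEuler_iff_singIn.1 hv)
    ((hasEuler_iff_sup hU hV hUV).1 hx)
  exact hasEuler_iff_singIn.2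
    ((HasEulerChar.shortExact₂ h₁ (hasEuler_iff_singIn.1 hw) hQ).congr (by ring))

open ContinuousMap in
theorem HasEuler.of_homotopyEquiv (h : HasEuler X e) (f : X ≃ₕ Y) : HasEuler Y e := by
  refine HasEulerChar.of_iso_homology h fun k => ⟨?_⟩
  let F := (AlgebraicTopology.singularChainComplexFunctor (ModuleCat.{0} ℚ)).obj (ModuleCat.of ℚ ℚ)
  exact
    { hom := HomologicalComplex.homologyMap (F.map (TopCat.ofHom f.toFun)) k
      inv := HomologicalComplex.homologyMap (F.map (TopCat.ofHom f.invFun)) k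
      hom_inv_id := by
        rw [← HomologicalComplex.homologyMap_comp, ← F.map_comp]
        have H : TopCat.Homotopy (TopCat.ofHom f.toFun ≫ TopCat.ofHom f.invFun)
          (𝟙 (TopCat.of X)) := f.left_inv.some
        rw [H.congr_homologyMap_singularChainComplexFunctor, F.map_id,
          HomologicalComplex.homologyMap_id]
      inv_hom_id := by
        rw [← HomologicalComplex.homologyMap_comp, ← F.map_comp]
        have H : TopCat.Homotopy (TopCat.ofHom f.invFun ≫ TopCat.ofHom f.toFun)
          (𝟙 (TopCat.of Y)) := f.right_inv.some
        rw [H.congr_homologyMap_singularChainComplexFunctor, F.map_id,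
          HomologicalComplex.homologyMap_id] }

theorem HasEuler.of_homeomorph (h : HasEuler X e) (f : X ≃ₜ Y) : HasEuler Y e :=
  h.of_homotopyEquiv f.toHomotopyEquiv

theorem hasEuler_of_totallyDisconnected [TotallyDisconnectedSpace X] [Finite X] :
    HasEuler X (Nat.card X) := by
  have h0 : Nonempty ((singularChains X).homology 0 ≅ (ModuleCat.free ℚ).obj X) :=
    ⟨AlgebraicTopology.singularHomologyFunctorZeroOfTotallyDisconnectedSpace (ModuleCat.{0} ℚ)
      (ModuleCat.of ℚ ℚ) (TopCat.of X) ≪≫ freeIso.app X⟩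
  have h1 : ∀ k, k ≠ 0 → Subsingleton ((singularChains X).homology k) := fun k hk =>
    ModuleCat.subsingleton_of_isZero
      (AlgebraicTopology.isZero_singularHomologyFunctor_of_totallyDisconnectedSpace
        (ModuleCat.{0} ℚ) k (ModuleCat.of ℚ ℚ) (TopCat.of X) hk)
  have l : (singularChains X).homology 0 ≃ₗ[ℚ] (X →₀ ℚ) := h0.some.toLinearEquiv
  refine hasEulerChar_of_bound 1 (fun k => ?_) (fun k hk => h1 k (by omega)) ?_
  · rcases Nat.eq_zero_or_pos k with rfl | hk
    · exact Module.Finite.equiv l.symm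
    · have := h1 k (by omega)
      infer_instance
  · rw [homologyEulerChar_eq_sum _ 1 fun k hk => h1 k (by omega)]
    have := Fintype.ofFinite X
    simp [l.finrank_eq]

theorem hasEuler_of_contractible [ContractibleSpace X] : HasEuler X 1 := by
  have h : HasEuler Unit 1 := hasEuler_of_totallyDisconnected.congr (by simp)
  exact h.of_homotopyEquiv (ContractibleSpace.hequiv_unit X).some.symm

theorem hasEuler_of_isEmpty [IsEmpty X] : HasEuler X 0 :=
  hasEuler_of_totallyDisconnected.congr (by simp)

end

/-! ### Removing a hyperplane section -/

section

variable {X Y : Type} [TopologicalSpace X] [TopologicalSpace Y]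

/-- Mutually inverse continuous maps between two subsets form a homeomorphism. -/
def homeomorphOfMaps {A : Set X} {B : Set Y} (f : X → Y) (g : Y → X) (hf : ContinuousOn f A)
    (hg : ContinuousOn g B) (hAB : Set.MapsTo f A B) (hBA : Set.MapsTo g B A)
    (hgf : ∀ a ∈ A, g (f a) = a) (hfg : ∀ b ∈ B, f (g b) = b) : A ≃ₜ B where
  toFun := hAB.restrict
  invFun := hBA.restrict
  left_inv a := Subtype.ext (hgf a a.2)
  right_inv b := Subtype.ext (hfg b b.2)
  continuous_toFun := hf.mapsToRestrict hAB
  continuous_invFun := hg.mapsToRestrict hBA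

/-- A subset of a subspace as a subset of the ambient space. -/
def preimageHomeomorph (A U : Set X) : ((↑) ⁻¹' U : Set A) ≃ₜ (A ∩ U : Set X) where
  toFun x := ⟨x.1.1, x.1.2, x.2⟩
  invFun x := ⟨⟨x.1, x.2.1⟩, x.2.2⟩
  left_inv _ := rfl
  right_inv _ := rfl
  continuous_toFun := by fun_prop
  continuous_invFun := by fun_prop

theorem HasEuler.of_eq {A B : Set X} {e : ℤ} (h : HasEuler A e) (hAB : A = B) : HasEuler B e :=
  hAB ▸ h

theorem HasEuler.union_sets {A U V : Set X} (hU : IsOpen U) (hV : IsOpen V) (hA : A ⊆ U ∪ V)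
    {u v w : ℤ} (hu : HasEuler (A ∩ U : Set X) u) (hv : HasEuler (A ∩ V : Set X) v)
    (hw : HasEuler (A ∩ (U ∩ V) : Set X) w) : HasEuler A (u + v - w) :=
  HasEuler.union (U := (↑) ⁻¹' U) (V := (↑) ⁻¹' V) (hU.preimage continuous_subtype_val)
    (hV.preimage continuous_subtype_val) (Set.eq_univ_of_forall fun x => hA x.2)
    (hu.of_homeomorph (preimageHomeomorph A U).symm)
    (hv.of_homeomorph (preimageHomeomorph A V).symm)
    (by exact hw.of_homeomorph (preimageHomeomorph A (U ∩ V)).symm)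

theorem HasEuler.of_union_sets {A U V : Set X} (hU : IsOpen U) (hV : IsOpen V) (hA : A ⊆ U ∪ V)
    {x v w : ℤ} (hx : HasEuler A x) (hv : HasEuler (A ∩ V : Set X) v)
    (hw : HasEuler (A ∩ (U ∩ V) : Set X) w) : HasEuler (A ∩ U : Set X) (x + w - v) :=
  (HasEuler.of_union (U := (↑) ⁻¹' U) (V := (↑) ⁻¹' V) (hU.preimage continuous_subtype_val)
    (hV.preimage continuous_subtype_val) (Set.eq_univ_of_forall fun x => hA x.2) hx
    (hv.of_homeomorph (preimageHomeomorph A V).symm)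
    (by exact hw.of_homeomorph (preimageHomeomorph A (U ∩ V)).symm)).of_homeomorph
      (preimageHomeomorph A U)

theorem HasEuler.prod_contractible {e : ℤ} (h : HasEuler X e) [ContractibleSpace Y] :
    HasEuler (X × Y) e :=
  (h.of_homeomorph (Homeomorph.prodPUnit X).symm).of_homotopyEquiv
    ((ContinuousMap.HomotopyEquiv.refl X).prodCongr (ContractibleSpace.hequiv_unit Y).some.symm)

theorem HasEuler.prod_set {e : ℤ} {A : Set X} {K : Set Y} (h : HasEuler (A × K) e) :
    HasEuler (A ×ˢ K : Set (X × Y)) e :=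
  h.of_homeomorph (Homeomorph.Set.prod A K).symm

theorem HasEuler.prod_starConvex {e : ℤ} {A : Set X} (h : HasEuler A e) {K : Set ℂ} {x : ℂ}
    (hK : StarConvex ℝ x K) (hx : x ∈ K) : HasEuler (A ×ˢ K : Set (X × ℂ)) e := by
  have := hK.contractibleSpace ⟨x, hx⟩
  exact h.prod_contractible.prod_set

/-- The punctured disc, like the circle, contributes zero: it is covered by two slit discs, which
meet in two half-discs. -/
theorem HasEuler.prod_puncturedDisc {e : ℤ} {A : Set X} (h : HasEuler A e) :
    HasEuler (A ×ˢ (Metric.ball (0 : ℂ) 1 \ {0}) : Set (X × ℂ)) 0 := by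
  have hD : Convex ℝ (Metric.ball (0 : ℂ) 1) := convex_ball _ _
  have mem : ∀ {c : ℂ}, ‖c‖ < 1 → c ∈ Metric.ball (0 : ℂ) 1 := by simp
  have m₁ : (2⁻¹ : ℂ) ∈ Metric.ball (0 : ℂ) 1 := mem (by norm_num)
  have m₂ : (-2⁻¹ : ℂ) ∈ Metric.ball (0 : ℂ) 1 := mem (by norm_num)
  have m₃ : Complex.I / 2 ∈ Metric.ball (0 : ℂ) 1 := mem (by norm_num)
  have m₄ : -Complex.I / 2 ∈ Metric.ball (0 : ℂ) 1 := mem (by norm_num)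
  have s₁ : StarConvex ℝ 2⁻¹ Complex.slitPlane :=
    Complex.starConvex_slitPlane (by norm_num [Complex.lt_def])
  have n₁ : (2⁻¹ : ℂ) ∈ Complex.slitPlane := by norm_num [Complex.mem_slitPlane_iff]
  have hre : ∀ c : ℂ, c ≠ 0 ↔ c.re ≠ 0 ∨ c.im ≠ 0 := fun c => by
    rw [Ne, Complex.ext_iff, not_and_or]; rfl
  -- the disc cut along a half-axis, and the two halves of the disc
  have h₁ := h.prod_starConvex ((hD.starConvex m₁).inter s₁) ⟨m₁, n₁⟩
  have h₂ := h.prod_starConvex ((hD.starConvex m₂).inter s₁.neg) ⟨m₂, Set.neg_mem_neg.2 n₁⟩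
  have h₃ := h.prod_starConvex ((hD.starConvex m₃).inter
    ((convex_halfSpace_im_gt 0).starConvex (x := Complex.I / 2) (by simp))) ⟨m₃, by simp⟩
  have h₄ := h.prod_starConvex ((hD.starConvex m₄).inter
    ((convex_halfSpace_im_lt 0).starConvex (x := -Complex.I / 2) (by norm_num))) ⟨m₄, by norm_num⟩
  have h₅ : HasEuler (A ×ˢ (Metric.ball 0 1 ∩ {c | c.im ≠ 0}) : Set (X × ℂ)) (e + e - 0) := by
    refine HasEuler.union_sets (U := {p | 0 < p.2.im}) (V := {p | p.2.im < 0}) ?_ ?_ ?_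
      (h₃.of_eq ?_) (h₄.of_eq ?_) ?_
    · exact isOpen_lt continuous_const (Complex.continuous_im.comp continuous_snd)
    · exact isOpen_lt (Complex.continuous_im.comp continuous_snd) continuous_const
    · rintro ⟨a, c⟩ ⟨_, _, hc⟩
      exact (lt_or_gt_of_ne hc).symm
    · ext ⟨a, c⟩
      exact ⟨fun h => ⟨⟨h.1, h.2.1, ne_of_gt h.2.2⟩, h.2.2⟩, fun h => ⟨h.1.1, h.1.2.1, h.2⟩⟩
    · ext ⟨a, c⟩
      exact ⟨fun h => ⟨⟨h.1, h.2.1, ne_of_lt h.2.2⟩, h.2.2⟩, fun h => ⟨h.1.1, h.1.2.1, h.2⟩⟩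
    · have : IsEmpty ((A ×ˢ (Metric.ball 0 1 ∩ {c : ℂ | c.im ≠ 0}) ∩
          ({p | 0 < p.2.im} ∩ {p | p.2.im < 0}) : Set (X × ℂ))) :=
        ⟨fun p => lt_asymm (show 0 < p.1.2.im from p.2.2.1) p.2.2.2⟩
      exact hasEuler_of_isEmpty
  refine (HasEuler.union_sets (U := {p | p.2 ∈ Complex.slitPlane})
    (V := {p | p.2 ∈ -Complex.slitPlane}) ?_ ?_ ?_ (h₁.of_eq ?_) (h₂.of_eq ?_)
      (h₅.of_eq ?_)).congr (by ring)
  · exact Complex.isOpen_slitPlane.preimage continuous_snd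
  · exact Complex.isOpen_slitPlane.neg.preimage continuous_snd
  · rintro ⟨a, c⟩ ⟨_, _, hc⟩
    rcases (hre c).1 hc with h | h
    · exact h.lt_or_gt.symm.imp Or.inl fun h => Or.inl (by simpa using h)
    · exact Or.inl (Or.inr h)
  · ext ⟨a, c⟩
    exact ⟨fun h => ⟨⟨h.1, h.2.1, Complex.slitPlane_ne_zero h.2.2⟩, h.2.2⟩,
      fun h => ⟨h.1.1, h.1.2.1, h.2⟩⟩
  · ext ⟨a, c⟩
    exact ⟨fun h => ⟨⟨h.1, h.2.1, neg_ne_zero.1 (Complex.slitPlane_ne_zero h.2.2)⟩, h.2.2⟩,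
      fun h => ⟨h.1.1, h.1.2.1, h.2⟩⟩
  · ext ⟨a, c⟩
    constructor
    · rintro ⟨h1, h2, h3⟩
      exact ⟨⟨h1, h2, (hre c).2 (Or.inr h3)⟩, Or.inr h3, Or.inr (by simpa using h3)⟩
    · rintro ⟨⟨h1, h2, _⟩, h3, h4⟩
      refine ⟨h1, h2, fun h0 => ?_⟩
      have h3 := h3.resolve_right (not_not.2 h0)
      have h4 := h4.resolve_right (by simpa using h0)
      simp at h4
      exact lt_asymm h3 h4

end

/-- Removing a hyperplane section: in a set `F ∩ O`, where `O` is open and `F` is invariant under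
translation in the direction `u`, the hyperplane section `φ = 0` transverse to `u` has a tubular
neighbourhood that is a bundle of discs, and the punctured discs contribute zero. -/
theorem HasEuler.deletion {E : Type} [NormedAddCommGroup E] [NormedSpace ℂ E] {φ : E →ₗ[ℂ] ℂ}
    (hφ : Continuous φ) {u : E} (hu : φ u = 1) {F O : Set E} (hO : IsOpen O)
    (hF : ∀ v ∈ F, ∀ t : ℂ, v + t • u ∈ F) {y z : ℤ} (hy : HasEuler (F ∩ O : Set E) y)
    (hz : HasEuler ((F ∩ O) ∩ {v | φ v = 0} : Set E) z) :
    HasEuler ((F ∩ O) ∩ {v | φ v ≠ 0} : Set E) (y - z) := by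
  have hu0 : 0 < ‖u‖ := norm_pos_iff.2 fun h => by simp [h] at hu
  -- the open set is shrunk to have a nonempty complement, since the distance to the empty set is
  -- zero by convention
  set O' : Set E := O ∩ {v | ‖φ v‖ < 1}
  have hO' : IsOpen O' := hO.inter (isOpen_lt hφ.norm continuous_const)
  have hne : O'ᶜ.Nonempty := ⟨u, fun h => by simpa [hu] using h.2⟩
  set d : E → ℝ := fun v => Metric.infDist v O'ᶜ
  have hd : Continuous d := Metric.continuous_infDist_pt _
  have hdpos : ∀ v, 0 < d v ↔ v ∈ O' := fun v => by
    rw [← hO'.isClosed_compl.notMem_iff_infDist_pos hne, Set.notMem_compl_iff]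
  set π : E → E := fun v => v - φ v • u
  have hπ : Continuous π := continuous_id.sub (hφ.smul continuous_const)
  have hφπ : ∀ v, φ (π v) = 0 := fun v => by simp [π, hu]
  have hπF : ∀ v ∈ F, π v ∈ F := fun v hv => by
    simpa [π, sub_eq_add_neg] using hF v hv (-φ v)
  set Z : Set E := (F ∩ O) ∩ {v | φ v = 0}
  have hdZ : ∀ v ∈ Z, 0 < d v := fun v hv => (hdpos v).2 ⟨hv.1.2, by
    have : φ v = 0 := hv.2
    simp [this]⟩
  -- the tubular neighbourhood: points closer to their projection than the projection is to the
  -- complement of `O'`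
  set V : Set E := {v | ‖φ v‖ * ‖u‖ < d (π v)}
  have hVZ : ∀ v ∈ F, v ∈ V → π v ∈ Z := fun v hvF hv =>
    ⟨⟨hπF v hvF, ((hdpos _).1 ((by positivity : 0 ≤ ‖φ v‖ * ‖u‖).trans_lt hv)).1⟩, hφπ v⟩
  have hVO : ∀ v ∈ V, v ∈ O := fun v hv => by
    by_contra h
    have h1 : d (π v) ≤ dist (π v) v := Metric.infDist_le_dist_of_mem fun h' => h h'.1
    have h2 : dist (π v) v = ‖φ v‖ * ‖u‖ := by
      rw [dist_eq_norm, ← norm_neg, ← norm_smul]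
      simp [π]
    exact absurd hv (not_lt.2 (h1.trans h2.le))
  -- the trivialization of the tubular neighbourhood
  set f : E → E × ℂ := fun v => (π v, φ v * (‖u‖ / d (π v) : ℝ))
  set g : E × ℂ → E := fun p => p.1 + (p.2 * (d p.1 / ‖u‖ : ℝ)) • u
  have hg : Continuous g := by
    refine continuous_fst.add (Continuous.smul ?_ continuous_const)
    exact continuous_snd.mul
      (Complex.continuous_ofReal.comp ((hd.comp continuous_fst).div_const _))
  have hφg : ∀ p, φ p.1 = 0 → φ (g p) = p.2 * (d p.1 / ‖u‖ : ℝ) := fun p hp => by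
    simp only [g, map_add, hp, map_smul, hu, smul_eq_mul, mul_one, zero_add]
  have hπg : ∀ p, φ p.1 = 0 → π (g p) = p.1 := fun p hp => by
    simp only [π]
    rw [hφg p hp]
    simp [g]
  have hf : ∀ s ⊆ F ∩ V, ContinuousOn f s := fun s hs => by
    refine hπ.continuousOn.prodMk (hφ.continuousOn.mul
      (Complex.continuous_ofReal.comp_continuousOn ?_))
    refine continuousOn_const.div (hd.comp hπ).continuousOn fun v hv => ?_
    exact (hdZ _ (hVZ v (hs hv).1 (hs hv).2)).ne'
  have hgf : ∀ v ∈ F, v ∈ V → g (f v) = v := fun v hvF hv => by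
    have h0 := (hdZ _ (hVZ v hvF hv)).ne'
    have : ((‖u‖ / d (π v) : ℝ) : ℂ) * (d (π v) / ‖u‖ : ℝ) = 1 := by
      rw [← Complex.ofReal_mul]
      field_simp
      simp
    simp only [g, f]
    rw [mul_assoc, this, mul_one]
    simp [π]
  have hfg : ∀ p : E × ℂ, p.1 ∈ Z → f (g p) = p := fun p hp => by
    have h0 := (hdZ _ hp).ne'
    have : ((d p.1 / ‖u‖ : ℝ) : ℂ) * (‖u‖ / d p.1 : ℝ) = 1 := by
      rw [← Complex.ofReal_mul]
      field_simp
      simp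
    simp only [f]
    rw [hπg p hp.2, hφg p hp.2, mul_assoc, this, mul_one]
  have hfmaps : ∀ v ∈ F, v ∈ V → f v ∈ Z ×ˢ Metric.ball (0 : ℂ) 1 := fun v hvF hv => by
    refine ⟨hVZ v hvF hv, ?_⟩
    have h0 := hdZ _ (hVZ v hvF hv)
    simp only [f, mem_ball_zero_iff, norm_mul, Complex.norm_real, Real.norm_of_nonneg
      (div_nonneg hu0.le h0.le)]
    rw [← mul_div_assoc, div_lt_one h0]
    exact hv
  have hgmaps : ∀ p ∈ Z ×ˢ Metric.ball (0 : ℂ) 1, g p ∈ (F ∩ O) ∩ V := fun p hp => by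
    have h0 := hdZ _ hp.1
    have hV : g p ∈ V := by
      change ‖φ (g p)‖ * ‖u‖ < d (π (g p))
      rw [hπg p hp.1.2, hφg p hp.1.2, norm_mul, Complex.norm_real, Real.norm_of_nonneg
        (div_nonneg h0.le hu0.le), mul_assoc, div_mul_cancel₀ _ hu0.ne']
      exact mul_lt_of_lt_one_left h0 (by simpa using hp.2)
    exact ⟨⟨hF _ hp.1.1.1 _, hVO _ hV⟩, hV⟩
  have hφ0 : ∀ p : E × ℂ, p.1 ∈ Z → (φ (g p) ≠ 0 ↔ p.2 ≠ 0) := fun p hp => by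
    have h0 := hdZ _ hp
    rw [hφg p hp.2, Ne, mul_eq_zero, not_or]
    refine and_iff_left ?_
    exact_mod_cast (div_pos h0 hu0).ne'
  have tube : HasEuler ((F ∩ O) ∩ V : Set E) z :=
    (hz.prod_starConvex ((convex_ball (0 : ℂ) 1).starConvex (by simp)) (x := 0)
      (by simp)).of_homeomorph (homeomorphOfMaps f g (hf _ fun v hv => ⟨hv.1.1, hv.2⟩)
        hg.continuousOn
        (fun v hv => hfmaps v hv.1.1 hv.2) hgmaps (fun v hv => hgf v hv.1.1 hv.2)
        fun p hp => hfg p hp.1).symm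
  have punctured : HasEuler ((F ∩ O) ∩ ({v | φ v ≠ 0} ∩ V) : Set E) 0 :=
    hz.prod_puncturedDisc.of_homeomorph
      (homeomorphOfMaps f g (hf _ fun v hv => ⟨hv.1.1, hv.2.2⟩) hg.continuousOn
        (fun v hv => by
          have h := hfmaps v hv.1.1 hv.2.2
          refine ⟨h.1, h.2, (hφ0 _ h.1).1 ?_⟩
          rw [hgf v hv.1.1 hv.2.2]
          exact hv.2.1)
        (fun p hp => by
          have h := hgmaps p ⟨hp.1, hp.2.1⟩
          exact ⟨h.1, (hφ0 p hp.1).2 hp.2.2, h.2⟩) (fun v hv => hgf v hv.1.1 hv.2.2)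
        fun p hp => hfg p hp.1).symm
  refine (HasEuler.of_union_sets (isOpen_ne_fun hφ continuous_const)
    (isOpen_lt (hφ.norm.mul continuous_const) (hd.comp hπ)) (fun v hv => ?_) hy tube
      punctured).congr (by ring)
  by_cases h : φ v = 0
  · refine Or.inr ?_
    have hπv : π v = v := by simp [π, h]
    change ‖φ v‖ * ‖u‖ < d (π v)
    rw [hπv, h, norm_zero, zero_mul]
    exact hdZ v ⟨hv, h⟩
  · exact Or.inl h

/-! ### Affine arrangements in general position -/

section GeneralPosition

variable {n r : ℕ} {l : Fin r → Module.Dual ℂ (Fin (n + 1) → ℂ)}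

/-- Independent forms take arbitrary prescribed values. -/
theorem exists_forall_apply_eq {T : Finset (Fin r)} (hT : LinearIndependent ℂ fun i : T => l i)
    (c : Fin r → ℂ) : ∃ v, ∀ i ∈ T, l i v = c i := by
  obtain ⟨f, hf⟩ := LinearMap.exists_extend ((Module.Basis.span hT).constr ℂ fun i => c i)
  refine ⟨(Module.evalEquiv ℂ (Fin (n + 1) → ℂ)).symm f, fun i hi => ?_⟩
  rw [Module.apply_evalEquiv_symm_apply]
  have := LinearMap.congr_fun hf (Module.Basis.span hT ⟨i, hi⟩)
  rw [Module.Basis.constr_basis] at this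
  rw [← this, LinearMap.comp_apply, Submodule.subtype_apply, Module.Basis.span_apply]

/-- In general position, `n + 1` of the forms have no common zero except the origin. -/
theorem InGeneralPosition.eq_zero (hl : InGeneralPosition l) {T : Finset (Fin r)}
    (hT : n + 1 ≤ T.card) {v : Fin (n + 1) → ℂ} (hv : ∀ i ∈ T, l i v = 0) : v = 0 := by
  obtain ⟨T', hT', hc⟩ := Finset.exists_subset_card_eq hT
  have hi := hl T' hc.le
  have hs := hi.span_eq_top_of_card_eq_finrank' (by simp [hc])
  refine (Module.forall_dual_apply_eq_zero_iff ℂ v).1 fun f => ?_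
  have hf : f ∈ Submodule.span ℂ (Set.range fun i : T' => l i) := hs ▸ Submodule.mem_top
  induction hf using Submodule.span_induction with
  | mem x hx => obtain ⟨i, rfl⟩ := hx; exact hv i (hT' i.2)
  | zero => rfl
  | add x y _ _ hx hy => rw [LinearMap.add_apply, hx, hy, add_zero]
  | smul a x _ hx => rw [LinearMap.smul_apply, hx, smul_zero]

/-- The part of the affine chart `l i₀ = 1` on which the forms in `B` vanish and the forms in `I` do
not. -/
def affineStratum (l : Fin r → Module.Dual ℂ (Fin (n + 1) → ℂ)) (i₀ : Fin r)
    (B I : Finset (Fin r)) : Set (Fin (n + 1) → ℂ) :=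
  {v | l i₀ v = 1 ∧ ∀ i ∈ B, l i v = 0} ∩ {v | ∀ i ∈ I, l i v ≠ 0}

/-- The Euler number of the complement of `s` hyperplanes in general position in affine space of
dimension `d - 1`, which is empty for `d = 0`. -/
def affineEuler (d s : ℕ) : ℤ := ∑ j ∈ Finset.range d, (-1) ^ j * (s.choose j : ℤ)

theorem affineEuler_succ_succ (d s : ℕ) :
    affineEuler (d + 1) (s + 1) = affineEuler (d + 1) s - affineEuler d s := by
  simp only [affineEuler, Finset.sum_range_succ' _ d, Nat.choose_succ_succ, Nat.choose_zero_right]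
  rw [add_sub_right_comm, ← Finset.sum_sub_distrib]
  congr 1
  refine Finset.sum_congr rfl fun j _ => ?_
  push_cast
  ring

/-- Deletion and restriction: the hyperplanes in `I` are removed one at a time, and on the section
by the last one the others are again in general position. -/
theorem hasEuler_affineStratum (hl : InGeneralPosition l) {i₀ : Fin r} {B I : Finset (Fin r)}
    (hB : i₀ ∉ B) (hI : i₀ ∉ I) (hBI : Disjoint B I) {d : ℕ} (hd : B.card + d = n + 1) :
    HasEuler (affineStratum l i₀ B I) (affineEuler d I.card) := by
  have hcont : ∀ i, Continuous (l i) := fun i => (l i).continuous_of_finiteDimensional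
  have hempty : ∀ {B : Finset (Fin r)} (I : Finset (Fin r)), n + 1 ≤ B.card →
      IsEmpty (affineStratum l i₀ B I) := fun I h => ⟨fun v => by
    have := v.2.1.1
    rw [hl.eq_zero h v.2.1.2, map_zero] at this
    exact zero_ne_one this⟩
  induction I using Finset.induction generalizing B d with
  | empty =>
    cases d with
    | zero =>
      have := hempty (B := B) ∅ (by omega)
      exact hasEuler_of_isEmpty
    | succ d =>
      obtain ⟨v, hv⟩ := exists_forall_apply_eq (hl (insert i₀ B)
        (by rw [Finset.card_insert_of_notMem hB]; omega)) (fun i => if i = i₀ then 1 else 0)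
      have hne : (affineStratum l i₀ B ∅).Nonempty := by
        refine ⟨v, ⟨by simpa using hv i₀ (by simp), fun i hi => ?_⟩, by simp⟩
        rw [hv i (by simp [hi]), if_neg (ne_of_mem_of_not_mem hi hB)]
      have hconv : Convex ℝ (affineStratum l i₀ B ∅) := by
        intro v hv w hw a b _ _ hab
        have key : ∀ i, l i (a • v + b • w) = a • l i v + b • l i w := fun i => by
          rw [map_add]
          exact congrArg₂ _ (LinearMap.map_smul_of_tower _ _ _)
            (LinearMap.map_smul_of_tower _ _ _)
        refine ⟨⟨?_, fun i hi => ?_⟩, by simp⟩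
        · rw [key, hv.1.1, hw.1.1, ← add_smul, hab, one_smul]
        · rw [key, hv.1.2 i hi, hw.1.2 i hi, smul_zero, smul_zero, add_zero]
      have := hconv.contractibleSpace hne
      refine hasEuler_of_contractible.congr ?_
      simp [affineEuler, Finset.sum_range_succ']
  | insert j I hj ih =>
    rw [Finset.card_insert_of_notMem hj]
    have hI' : i₀ ∉ I := fun h => hI (Finset.mem_insert_of_mem h)
    have hji : j ≠ i₀ := fun h => hI (h ▸ Finset.mem_insert_self _ _)
    have hjB : j ∉ B := fun h => (Finset.disjoint_left.1 hBI) h (Finset.mem_insert_self _ _)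
    have hBI' : Disjoint B I := hBI.mono_right (Finset.subset_insert _ _)
    have hyp : (affineStratum l i₀ B I) ∩ {v | l j v ≠ 0} = affineStratum l i₀ B (insert j I) := by
      ext v
      simp only [affineStratum, Finset.forall_mem_insert]
      exact ⟨fun h => ⟨h.1.1, h.2, h.1.2⟩, fun h => ⟨⟨h.1, h.2.2⟩, h.2.1⟩⟩
    have hyp' : (affineStratum l i₀ B I) ∩ {v | l j v = 0} = affineStratum l i₀ (insert j B) I := by
      ext v
      simp only [affineStratum, Finset.forall_mem_insert]
      exact ⟨fun h => ⟨⟨h.1.1.1, h.2, h.1.1.2⟩, h.1.2⟩,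
        fun h => ⟨⟨⟨h.1.1, h.1.2.2⟩, h.2⟩, h.1.2.1⟩⟩
    have hy := ih hB hI' hBI' hd
    match d, hd, hy with
    | 0, hd, _ =>
      have := hempty (B := B) (insert j I) (by omega)
      exact hasEuler_of_isEmpty
    | 1, hd, hy =>
      -- the hyperplane `l j = 0` does not meet the point `l i₀ = 1`, `l i = 0` for `i ∈ B`
      refine (hy.of_eq ?_).congr (by simp [affineEuler])
      rw [← hyp, eq_comm, Set.inter_eq_left]
      intro v hv h0
      exact (hempty (B := insert j B) I
        (by rw [Finset.card_insert_of_notMem hjB]; omega)).elim ⟨v, hyp' ▸ ⟨hv, h0⟩⟩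
    | d + 2, hd, hy =>
      obtain ⟨u, hu⟩ := exists_forall_apply_eq (hl (insert j (insert i₀ B)) (by
        refine (Finset.card_insert_le _ _).trans ?_
        rw [Finset.card_insert_of_notMem hB]; omega)) (fun i => if i = j then 1 else 0)
      have huj : l j u = 1 := by simpa using hu j (by simp)
      have hu0 : l i₀ u = 0 := by rw [hu i₀ (by simp), if_neg hji.symm]
      have huB : ∀ i ∈ B, l i u = 0 := fun i hi => by
        rw [hu i (by simp [hi]), if_neg (ne_of_mem_of_not_mem hi hjB)]
      rw [affineEuler_succ_succ]
      refine (HasEuler.deletion (hcont j) huj ?_ ?_ hy ?_).of_eq hyp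
      · have : {v | ∀ i ∈ I, l i v ≠ 0} = ⋂ i ∈ I, {v | l i v ≠ 0} := by ext; simp
        rw [this]
        exact isOpen_biInter_finset fun i _ => isOpen_ne_fun (hcont i) continuous_const
      · rintro v ⟨h0, h⟩ t
        refine ⟨?_, fun i hi => ?_⟩
        · rw [map_add, map_smul, h0, hu0, smul_zero, add_zero]
        · rw [map_add, map_smul, h i hi, huB i hi, smul_zero, add_zero]
      · refine HasEuler.of_eq (ih (B := insert j B) (d := d + 1) ?_ hI' ?_ ?_) hyp'.symm
        · simp [hB, hji.symm]
        · rw [Finset.disjoint_insert_left]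
          exact ⟨hj, hBI'⟩
        · rw [Finset.card_insert_of_notMem hjB]; omega

end GeneralPosition

/-! ### Retractions and punctured vector spaces -/

section DeformationRetract

variable {X : Type} [TopologicalSpace X]

open unitInterval in
/-- A deformation retraction of `A` onto `B`, given by a map on the ambient space, yields a
homotopy equivalence. -/
def homotopyEquivOfRetract {A B : Set X} (G : X × I → X) (hG : ContinuousOn G (A ×ˢ Set.univ))
    (hA : ∀ a ∈ A, ∀ t, G (a, t) ∈ A) (h0 : ∀ a ∈ A, G (a, 0) = a) (h1 : ∀ a ∈ A, G (a, 1) ∈ B)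
    (hBA : B ⊆ A) (hB : ∀ b ∈ B, G (b, 1) = b) : ContinuousMap.HomotopyEquiv A B where
  toFun := ⟨fun a => ⟨G (a, 1), h1 a a.2⟩, by
    refine Continuous.subtype_mk ?_ _
    exact hG.comp_continuous (f := fun a : A => ((a : X), (1 : I))) (by fun_prop)
      fun a => ⟨a.2, trivial⟩⟩
  invFun := ⟨Set.inclusion hBA, continuous_inclusion hBA⟩
  left_inv := ⟨ContinuousMap.Homotopy.symm
    { toFun := fun p => ⟨G (p.2, p.1), hA _ p.2.2 _⟩
      continuous_toFun := by
        refine Continuous.subtype_mk ?_ _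
        exact hG.comp_continuous (f := fun p : I × A => ((p.2 : X), p.1)) (by fun_prop)
          fun p => ⟨p.2.2, trivial⟩
      map_zero_left := fun a => Subtype.ext (h0 a a.2)
      map_one_left := fun a => rfl }⟩
  right_inv := by
    have : (⟨fun a => ⟨G (a, 1), h1 a a.2⟩, by
      refine Continuous.subtype_mk ?_ _
      exact hG.comp_continuous (f := fun a : A => ((a : X), (1 : I))) (by fun_prop)
        fun a => ⟨a.2, trivial⟩⟩ : C(A, B)).comp ⟨Set.inclusion hBA, continuous_inclusion hBA⟩ =
        ContinuousMap.id B := ContinuousMap.ext fun b => Subtype.ext (hB b b.2)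
    rw [this]

end DeformationRetract

section Punctured

variable {E : Type} [NormedAddCommGroup E] [NormedSpace ℂ E]

theorem hasEuler_submodule (W : Submodule ℂ E) : HasEuler (W : Set E) 1 := by
  have : Convex ℝ (W : Set E) := (W.restrictScalars ℝ).convex
  have := this.contractibleSpace ⟨0, W.zero_mem⟩
  exact hasEuler_of_contractible

theorem finrank_inf_ker_add_one [FiniteDimensional ℂ E] {W : Submodule ℂ E} {u : E} (hu : u ∈ W)
    {φ : E →ₗ[ℂ] ℂ} (hφ : φ u = 1) :
    Module.finrank ℂ (W ⊓ LinearMap.ker φ : Submodule ℂ E) + 1 = Module.finrank ℂ W := by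
  rw [← Submodule.map_comap_subtype, Submodule.finrank_map_subtype_eq, ← LinearMap.ker_comp]
  have hs : LinearMap.range (φ ∘ₗ W.subtype) = ⊤ := LinearMap.range_eq_top.2 fun c =>
    ⟨c • ⟨u, hu⟩, by simp [hφ]⟩
  have := LinearMap.finrank_range_add_finrank_ker (φ ∘ₗ W.subtype)
  rw [hs, finrank_top, Module.finrank_self] at this
  omega

/-- Outside the origin, one of `φ v` and `v - φ v • u` is nonzero. Both conditions define open sets
of Euler number zero, and so does their conjunction. -/
theorem hasEuler_submodule_ne_zero [FiniteDimensional ℂ E] (W : Submodule ℂ E) :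
    HasEuler ((W : Set E) ∩ {v | v ≠ 0} : Set E) 0 := by
  induction hd : Module.finrank ℂ W generalizing W with
  | zero =>
    rw [Submodule.finrank_eq_zero] at hd
    subst hd
    have : IsEmpty (((⊥ : Submodule ℂ E) : Set E) ∩ {v | v ≠ 0} : Set E) := ⟨fun v => v.2.2 v.2.1⟩
    exact hasEuler_of_isEmpty
  | succ d ih =>
    obtain ⟨u, huW, hu0⟩ := W.exists_mem_ne_zero_of_ne_bot fun h => by
      rw [h, finrank_bot] at hd
      omega
    obtain ⟨φ, hφu⟩ := Module.Projective.exists_dual_eq_one ℂ hu0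
    have hφ : Continuous φ := φ.continuous_of_finiteDimensional
    have hF : ∀ v ∈ (W : Set E), ∀ t : ℂ, v + t • u ∈ (W : Set E) := fun v hv t =>
      W.add_mem hv (W.smul_mem t huW)
    set π : E → E := fun v => v - φ v • u
    have hπ : Continuous π := continuous_id.sub (hφ.smul continuous_const)
    have hO : IsOpen {v | π v ≠ 0} := isOpen_ne_fun hπ continuous_const
    have hπ0 : ∀ v, φ v = 0 → π v = v := fun v hv => by simp [π, hv]
    -- the hyperplane `φ = 0` of `W`, without the origin
    have h₀ := ih (W ⊓ LinearMap.ker φ) (by have := finrank_inf_ker_add_one huW hφu; omega)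
    have h₁ : HasEuler ((W : Set E) ∩ {v | φ v ≠ 0} : Set E) (1 - 1) := by
      refine ((HasEuler.deletion hφ hφu (F := W) (O := Set.univ) isOpen_univ hF (y := 1) (z := 1)
        ?_ ?_).of_eq ?_)
      · exact (hasEuler_submodule W).of_eq (Set.inter_univ _).symm
      · refine (hasEuler_submodule (W ⊓ LinearMap.ker φ)).of_eq ?_
        ext v; simp
      · rw [Set.inter_univ]
    have h₂ : HasEuler ((W : Set E) ∩ {v | π v ≠ 0} : Set E) 0 := by
      refine (h₀.prod_starConvex (starConvex_univ (0 : ℂ)) trivial).of_homeomorph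
        (homeomorphOfMaps (fun p => p.1 + p.2 • u) (fun v => (π v, φ v)) (by fun_prop)
          (hπ.prodMk hφ).continuousOn ?_ ?_ ?_ ?_)
      · rintro ⟨w, t⟩ ⟨⟨⟨hw, hw0⟩, hw1⟩, _⟩
        refine ⟨hF w hw t, ?_⟩
        have : π (w + t • u) = w := by
          simp only [π, map_add, map_smul, hφu, LinearMap.mem_ker.1 hw0]
          simp
        rw [Set.mem_ofPred_eq, this]
        exact hw1
      · rintro v ⟨hv, hv0⟩
        refine ⟨⟨⟨?_, ?_⟩, hv0⟩, trivial⟩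
        · simpa [π, sub_eq_add_neg] using hF v hv (-φ v)
        · simp [π, hφu]
      · rintro ⟨w, t⟩ ⟨⟨⟨hw, hw0⟩, hw1⟩, _⟩
        simp only [π, map_add, map_smul, hφu, LinearMap.mem_ker.1 hw0]
        simp
      · rintro v -
        simp [π]
    have h₃ : HasEuler (((W : Set E) ∩ {v | π v ≠ 0}) ∩ {v | φ v ≠ 0} : Set E) (0 - 0) := by
      refine HasEuler.deletion hφ hφu hO hF h₂ (h₀.of_eq ?_)
      ext v
      constructor
      · rintro ⟨⟨h1, h2⟩, h3⟩
        exact ⟨⟨h1, by rwa [Set.mem_ofPred_eq, hπ0 v h2]⟩, h2⟩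
      · rintro ⟨⟨h1, h3⟩, h2⟩
        exact ⟨⟨h1, h2⟩, by rwa [Set.mem_ofPred_eq, hπ0 v h2] at h3⟩
    have ne₁ : ∀ v, φ v ≠ 0 → v ≠ 0 := fun v h h' => h (by rw [h', map_zero])
    have ne₂ : ∀ v, π v ≠ 0 → v ≠ 0 := fun v h h' => h (by simp [π, h'])
    have hφO : IsOpen {v | φ v ≠ 0} := isOpen_ne_fun hφ continuous_const
    refine (HasEuler.union_sets hφO hO (fun v hv => ?_)
      (h₁.of_eq ?_) (h₂.of_eq ?_) (h₃.of_eq ?_)).congr (by ring)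
    · by_cases h : φ v = 0
      · exact Or.inr (by rw [Set.mem_ofPred_eq, hπ0 v h]; exact hv.2)
      · exact Or.inl h
    · ext v
      exact ⟨fun h => ⟨⟨h.1, ne₁ v h.2⟩, h.2⟩, fun h => ⟨h.1.1, h.2⟩⟩
    · ext v
      exact ⟨fun h => ⟨⟨h.1, ne₂ v h.2⟩, h.2⟩, fun h => ⟨h.1.1, h.2⟩⟩
    · ext v
      exact ⟨fun h => ⟨⟨h.1.1, ne₁ v h.2⟩, h.2, h.1.2⟩, fun h => ⟨⟨h.1.1, h.2.2⟩, h.2.1⟩⟩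

end Punctured

/-! ### Charts of projective space -/

section Projective

variable {n : ℕ}

/-- The point of projective space with given homogeneous coordinates. The value at `0` is
irrelevant. -/
def toCP (v : Fin (n + 1) → ℂ) : CP n :=
  if h : v ≠ 0 then Projectivization.mk ℂ v h else Classical.arbitrary _

theorem toCP_eq {v : Fin (n + 1) → ℂ} (h : v ≠ 0) : toCP v = Projectivization.mk ℂ v h := dif_pos h

theorem toCP_rep (p : CP n) : toCP p.rep = p := by
  rw [toCP_eq p.rep_nonzero, Projectivization.mk_rep]

theorem toCP_smul {v : Fin (n + 1) → ℂ} {c : ℂ} (hc : c ≠ 0) : toCP (c • v) = toCP v := by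
  by_cases hv : v = 0
  · rw [hv, smul_zero]
  · rw [toCP_eq hv, toCP_eq (smul_ne_zero hc hv), Projectivization.mk_eq_mk_iff']
    exact ⟨c, rfl⟩

theorem rep_toCP {v : Fin (n + 1) → ℂ} (hv : v ≠ 0) : ∃ c : ℂ, c ≠ 0 ∧ (toCP v).rep = c • v := by
  rw [toCP_eq hv]
  obtain ⟨a, ha⟩ := Projectivization.exists_smul_eq_mk_rep ℂ v hv
  exact ⟨a, a.ne_zero, ha.symm⟩

theorem isOpenQuotientMap_mk' :
    IsOpenQuotientMap fun v : {v : Fin (n + 1) → ℂ // v ≠ 0} => Projectivization.mk' ℂ v := by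
  have hq : Topology.IsQuotientMap
      fun v : {v : Fin (n + 1) → ℂ // v ≠ 0} => Projectivization.mk' ℂ v :=
    { surjective := fun p => ⟨⟨p.rep, p.rep_nonzero⟩, p.mk_rep⟩, isCoinducing := ⟨rfl⟩ }
  refine IsOpenQuotientMap.of_isOpenMap_isQuotientMap (fun U hU => ?_) hq
  rw [← hq.isOpen_preimage]
  have : (fun v : {v : Fin (n + 1) → ℂ // v ≠ 0} => Projectivization.mk' ℂ v) ⁻¹'
      ((fun v => Projectivization.mk' ℂ v) '' U) = ⋃ a : ℂˣ,
        (fun v : {v : Fin (n + 1) → ℂ // v ≠ 0} =>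
          (⟨a • v.1, (smul_ne_zero_iff_ne a).2 v.2⟩ : {v : Fin (n + 1) → ℂ // v ≠ 0})) ⁻¹' U := by
    ext v
    simp only [Set.mem_preimage, Set.mem_image, Set.mem_iUnion, Projectivization.mk'_eq_mk]
    constructor
    · rintro ⟨w, hw, h⟩
      obtain ⟨a, ha⟩ := (Projectivization.mk_eq_mk_iff ℂ w.1 v.1 w.2 v.2).1 h
      exact ⟨a, by simpa only [ha] using hw⟩
    · rintro ⟨a, ha⟩
      exact ⟨_, ha, (Projectivization.mk_eq_mk_iff ℂ _ v.1 _ v.2).2 ⟨a, rfl⟩⟩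
  rw [this]
  refine isOpen_iUnion fun a => hU.preimage ?_
  exact Continuous.subtype_mk (continuous_subtype_val.const_smul a) _

theorem continuousOn_toCP : ContinuousOn (toCP (n := n)) {v | v ≠ 0} := by
  rw [continuousOn_iff_continuous_domRestrict]
  exact isOpenQuotientMap_mk'.continuous.congr fun v => (toCP_eq v.2).symm

/-- The points of projective space on a linear subspace. -/
def projSubspace (W : Submodule ℂ (Fin (n + 1) → ℂ)) : Set (CP n) := {p | p.rep ∈ W}

theorem toCP_mem_projSubspace {W : Submodule ℂ (Fin (n + 1) → ℂ)} {v : Fin (n + 1) → ℂ}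
    (hv : v ≠ 0) : toCP v ∈ projSubspace W ↔ v ∈ W := by
  obtain ⟨c, hc, h⟩ := rep_toCP hv
  rw [projSubspace, Set.mem_ofPred_eq, h, W.smul_mem_iff hc]

theorem isClosed_projSubspace (W : Submodule ℂ (Fin (n + 1) → ℂ)) :
    IsClosed (projSubspace W) := by
  rw [← isOpenQuotientMap_mk'.isQuotientMap.isClosed_preimage]
  have : (fun v : {v : Fin (n + 1) → ℂ // v ≠ 0} => Projectivization.mk' ℂ v) ⁻¹' projSubspace W =
      Subtype.val ⁻¹' (W : Set (Fin (n + 1) → ℂ)) := by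
    ext v
    rw [Set.mem_preimage, Projectivization.mk'_eq_mk, ← toCP_eq v.2, toCP_mem_projSubspace v.2]
    rfl
  rw [this]
  exact W.closed_of_finiteDimensional.preimage continuous_subtype_val

/-- The vector on the affine hyperplane `f = 1` that represents a given point. The value at points
of the hyperplane `f = 0` is irrelevant. -/
def chart (f : Module.Dual ℂ (Fin (n + 1) → ℂ)) (p : CP n) : Fin (n + 1) → ℂ :=
  (f p.rep)⁻¹ • p.rep

theorem chart_toCP (f : Module.Dual ℂ (Fin (n + 1) → ℂ)) {v : Fin (n + 1) → ℂ} (hv : v ≠ 0) :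
    chart f (toCP v) = (f v)⁻¹ • v := by
  obtain ⟨c, hc, h⟩ := rep_toCP hv
  rw [chart, h, map_smul, smul_eq_mul, mul_inv, smul_smul]
  congr 1
  field_simp

theorem continuousOn_chart (f : Module.Dual ℂ (Fin (n + 1) → ℂ)) :
    ContinuousOn (chart f) (projSubspace (LinearMap.ker f))ᶜ := by
  have hf : Continuous f := f.continuous_of_finiteDimensional
  rw [isOpenQuotientMap_mk'.isQuotientMap.continuousOn_isOpen_iff
    (isClosed_projSubspace _).isOpen_compl]
  have h : ∀ v : {v : Fin (n + 1) → ℂ // v ≠ 0}, Projectivization.mk' ℂ v = toCP v.1 := fun v =>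
    (toCP_eq v.2).symm
  refine ContinuousOn.congr (f := fun v => (f v.1)⁻¹ • v.1) ?_ fun v _ => ?_
  · refine ContinuousOn.smul (ContinuousOn.inv₀
      (hf.comp continuous_subtype_val).continuousOn fun v hv => ?_)
      continuous_subtype_val.continuousOn
    rw [Set.mem_preimage, h, Set.mem_compl_iff, toCP_mem_projSubspace v.2] at hv
    exact hv
  · simp only [Function.comp, h, chart_toCP f v.2]

/-- A subset `S` of the chart `f ≠ 0` is homeomorphic to the corresponding subset `M` of the affine
hyperplane `f = 1`. -/
def chartHomeomorph (f : Module.Dual ℂ (Fin (n + 1) → ℂ)) (S : Set (CP n))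
    (M : Set (Fin (n + 1) → ℂ)) (hM : ∀ v ∈ M, f v = 1)
    (hS : ∀ v, v ≠ 0 → (toCP v ∈ S ↔ f v ≠ 0 ∧ (f v)⁻¹ • v ∈ M)) : S ≃ₜ M := by
  have h0 : ∀ v ∈ M, v ≠ 0 := fun v hv h => by simpa [h] using hM v hv
  have hS' : ∀ p ∈ S, f p.rep ≠ 0 ∧ chart f p ∈ M := fun p hp =>
    (hS p.rep p.rep_nonzero).1 ((toCP_rep p).symm ▸ hp)
  exact homeomorphOfMaps (chart f) toCP
    ((continuousOn_chart f).mono fun p hp => (hS' p hp).1)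
    (continuousOn_toCP.mono h0) (fun p hp => (hS' p hp).2)
    (fun v hv => (hS v (h0 v hv)).2 ⟨by simp [hM v hv], by simpa [hM v hv] using hv⟩)
    (fun p hp => by rw [chart, toCP_smul (inv_ne_zero (hS' p hp).1), toCP_rep])
    (fun v hv => by rw [chart_toCP f (h0 v hv), hM v hv, inv_one, one_smul])

end Projective

/-! ### The Euler number of a projective subspace -/

section Projective

variable {n : ℕ}

/-- A homotopy in homogeneous coordinates that commutes with scaling is continuous on projective
space where it does not vanish. Representatives are chosen discontinuously, so the quotient map has
to be used. -/
theorem continuousOn_toCP_prod {U : Set (CP n)} (hU : IsOpen U)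
    {T : (Fin (n + 1) → ℂ) → unitInterval → Fin (n + 1) → ℂ}
    (hT : Continuous fun p : (Fin (n + 1) → ℂ) × unitInterval => T p.1 p.2)
    (hsmul : ∀ (c : ℂ) v t, T (c • v) t = c • T v t)
    (h0 : ∀ v t, v ≠ 0 → toCP v ∈ U → T v t ≠ 0) :
    ContinuousOn (fun p : CP n × unitInterval => toCP (T p.1.rep p.2)) (U ×ˢ Set.univ) := by
  have h : ∀ v : {v : Fin (n + 1) → ℂ // v ≠ 0}, Projectivization.mk' ℂ v = toCP v.1 := fun v =>
    (toCP_eq v.2).symm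
  rw [(isOpenQuotientMap_mk'.prodMap IsOpenQuotientMap.id).isQuotientMap.continuousOn_isOpen_iff
    (hU.prod isOpen_univ)]
  refine ContinuousOn.congr (f := fun p => toCP (T p.1.1 p.2)) ?_ ?_
  · refine continuousOn_toCP.comp
      (hT.comp ((continuous_subtype_val.comp continuous_fst).prodMk continuous_snd)).continuousOn ?_
    rintro ⟨v, t⟩ hv
    exact h0 v.1 t v.2 (by rw [← h]; exact hv.1)
  · rintro ⟨v, t⟩ -
    obtain ⟨c, hc, hr⟩ := rep_toCP v.2
    simp only [Function.comp, Prod.map, h, hr, hsmul, toCP_smul hc, id]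

/-- The complement of a point in a projective space retracts onto a hyperplane, and the complement
of the hyperplane is contractible. The two open sets meet in a punctured vector space. -/
theorem hasEuler_projSubspace (W : Submodule ℂ (Fin (n + 1) → ℂ)) :
    HasEuler (projSubspace W) (Module.finrank ℂ W) := by
  induction hd : Module.finrank ℂ W generalizing W with
  | zero =>
    rw [Submodule.finrank_eq_zero] at hd
    subst hd
    have : IsEmpty (projSubspace (⊥ : Submodule ℂ (Fin (n + 1) → ℂ))) :=
      ⟨fun p => p.1.rep_nonzero p.2⟩
    exact hasEuler_of_isEmpty
  | succ d ih =>
    obtain ⟨u, huW, hu0⟩ := W.exists_mem_ne_zero_of_ne_bot fun h => by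
      rw [h, finrank_bot] at hd
      omega
    obtain ⟨f, hfu⟩ := Module.Projective.exists_dual_eq_one ℂ hu0
    have hf : Continuous f := f.continuous_of_finiteDimensional
    -- the complement of the point `u` retracts onto the hyperplane `f = 0`
    set U : Set (CP n) := (projSubspace (Submodule.span ℂ {u}))ᶜ
    set V : Set (CP n) := (projSubspace (LinearMap.ker f))ᶜ
    have hU : IsOpen U := (isClosed_projSubspace _).isOpen_compl
    have hV : IsOpen V := (isClosed_projSubspace _).isOpen_compl
    have memU : ∀ v, v ≠ 0 → (toCP v ∈ U ↔ v ∉ Submodule.span ℂ {u}) := fun v hv =>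
      (toCP_mem_projSubspace hv).not
    have memV : ∀ v, v ≠ 0 → (toCP v ∈ V ↔ f v ≠ 0) := fun v hv =>
      (toCP_mem_projSubspace hv).not
    have hker : ∀ v, f v = 0 → v ∈ Submodule.span ℂ {u} → v = 0 := fun v hv h => by
      obtain ⟨c, rfl⟩ := Submodule.mem_span_singleton.1 h
      rw [map_smul, hfu, smul_eq_mul, mul_one] at hv
      rw [hv, zero_smul]
    have h₁ : HasEuler (projSubspace W ∩ U : Set (CP n)) d := by
      set T : (Fin (n + 1) → ℂ) → unitInterval → Fin (n + 1) → ℂ := fun v t =>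
        v - ((t : ℝ) * f v : ℂ) • u
      have hTU : ∀ v t, v ∉ Submodule.span ℂ {u} → T v t ∉ Submodule.span ℂ {u} := fun v t h h' =>
        h <| by simpa [T] using add_mem h' (Submodule.smul_mem _ ((t : ℝ) * f v : ℂ)
          (Submodule.mem_span_singleton_self u))
      have hT0 : ∀ v t, v ∉ Submodule.span ℂ {u} → T v t ≠ 0 := fun v t h h' =>
        hTU v t h (h' ▸ zero_mem _)
      have hrep : ∀ p ∈ U, p.rep ∉ Submodule.span ℂ {u} := fun p hp => hp
      have hW : ∀ p ∈ projSubspace W ∩ (projSubspace (LinearMap.ker f)), p ∈ U := fun p hp h =>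
        p.rep_nonzero (hker _ hp.2 h)
      refine (ih (W ⊓ LinearMap.ker f) (by have := finrank_inf_ker_add_one huW hfu; omega)
        ).of_homotopyEquiv (homotopyEquivOfRetract
          (fun p => toCP (T p.1.rep p.2)) ((continuousOn_toCP_prod hU ?_ ?_ ?_).mono
            (Set.prod_mono_left Set.inter_subset_right)) ?_ ?_ ?_ ?_ ?_).symm
      · fun_prop
      · intro c v t
        simp only [T, map_smul, smul_sub, smul_smul, smul_eq_mul]
        ring_nf
      · exact fun v t hv h => hT0 v t ((memU v hv).1 h)
      · intro p hp t
        have hp' := hrep p hp.2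
        exact ⟨(toCP_mem_projSubspace (hT0 _ t hp')).2 (W.sub_mem hp.1 (W.smul_mem _ huW)),
          (memU _ (hT0 _ t hp')).2 (hTU _ t hp')⟩
      · intro p hp
        simp [T, toCP_rep]
      · intro p hp
        refine (toCP_mem_projSubspace (hT0 _ 1 (hrep p hp.2))).2
          ⟨W.sub_mem hp.1 (W.smul_mem _ huW), ?_⟩
        simp [T, hfu]
      · exact fun p hp => ⟨hp.1, hW p ⟨hp.1, hp.2⟩⟩
      · intro p hp
        have : f p.rep = 0 := hp.2
        simp [T, this, toCP_rep]
    have h₂ : HasEuler (projSubspace W ∩ V : Set (CP n)) 1 := by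
      have hc : HasEuler ((W : Set (Fin (n + 1) → ℂ)) ∩ {v | f v = 1} : Set _) 1 := by
        refine (hasEuler_submodule (W ⊓ LinearMap.ker f)).of_homeomorph
          (homeomorphOfMaps (· + u) (· - u) (by fun_prop) (by fun_prop) ?_ ?_ ?_ ?_)
        · rintro v ⟨hv, hv0⟩
          exact ⟨W.add_mem hv huW, by simp [hfu, LinearMap.mem_ker.1 hv0]⟩
        · rintro v ⟨hv, hv1⟩
          exact ⟨W.sub_mem hv huW, by simp [hfu, Set.mem_ofPred_eq ▸ hv1]⟩
        · simp
        · simp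
      refine hc.of_homeomorph (chartHomeomorph f _ _ (fun v hv => hv.2) fun v hv => ?_).symm
      rw [Set.mem_inter_iff, toCP_mem_projSubspace hv, memV v hv, and_comm]
      refine and_congr_right fun h => ?_
      simp [h, W.smul_mem_iff (inv_ne_zero h)]
    have h₃ : HasEuler (projSubspace W ∩ (U ∩ V) : Set (CP n)) 0 := by
      have hc : HasEuler ((W : Set (Fin (n + 1) → ℂ)) ∩ {v | f v = 1} ∩ {v | v ≠ u} : Set _) 0 := by
        refine (hasEuler_submodule_ne_zero (W ⊓ LinearMap.ker f)).of_homeomorph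
          (homeomorphOfMaps (· + u) (· - u) (by fun_prop) (by fun_prop) ?_ ?_ ?_ ?_)
        · rintro v ⟨⟨hv, hv0⟩, hv1⟩
          exact ⟨⟨W.add_mem hv huW, by simp [hfu, LinearMap.mem_ker.1 hv0]⟩, by simpa using hv1⟩
        · rintro v ⟨⟨hv, hv1⟩, hv2⟩
          exact ⟨⟨W.sub_mem hv huW, by simp [hfu, Set.mem_ofPred_eq ▸ hv1]⟩, sub_ne_zero.2 hv2⟩
        · simp
        · simp
      refine hc.of_homeomorph (chartHomeomorph f _ _ (fun v hv => hv.1.2) fun v hv => ?_).symm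
      rw [Set.mem_inter_iff, Set.mem_inter_iff, toCP_mem_projSubspace hv, memV v hv, memU v hv]
      constructor
      · rintro ⟨h1, h2, h3⟩
        refine ⟨h3, ⟨W.smul_mem _ h1, by simp [h3]⟩, fun h => h2 ?_⟩
        refine Submodule.mem_span_singleton.2 ⟨f v, ?_⟩
        rw [← h, smul_smul, mul_inv_cancel₀ h3, one_smul]
      · rintro ⟨h3, ⟨h1, -⟩, h2⟩
        refine ⟨(W.smul_mem_iff (inv_ne_zero h3)).1 h1, fun h => h2 ?_, h3⟩
        obtain ⟨c, rfl⟩ := Submodule.mem_span_singleton.1 h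
        simp only [map_smul, hfu, smul_eq_mul, mul_one] at h3 ⊢
        rw [smul_smul, inv_mul_cancel₀ h3, one_smul]
    refine (HasEuler.union_sets hU hV (fun p hp => ?_) h₁ h₂ h₃).congr (by push_cast; ring)
    by_contra h
    rw [Set.mem_union, not_or, Set.notMem_compl_iff, Set.notMem_compl_iff] at h
    exact p.rep_nonzero (hker _ h.2 h.1)

end Projective

/-! ### The strata -/

section Strata

variable {n r : ℕ} {l : Fin r → Module.Dual ℂ (Fin (n + 1) → ℂ)}

theorem hyperplane_eq_projSubspace (f : Module.Dual ℂ (Fin (n + 1) → ℂ)) :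
    hyperplane f = projSubspace (LinearMap.ker f) := by
  ext p
  rw [hyperplane, Set.mem_ofPred_eq, p.submodule_eq, projSubspace, Set.mem_ofPred_eq]
  refine ⟨fun h => h _ (Submodule.mem_span_singleton_self _), fun h v hv => ?_⟩
  obtain ⟨c, rfl⟩ := Submodule.mem_span_singleton.1 hv
  rw [map_smul, LinearMap.mem_ker.1 h, smul_zero]

theorem toCP_mem_hyperplane {f : Module.Dual ℂ (Fin (n + 1) → ℂ)} {v : Fin (n + 1) → ℂ}
    (hv : v ≠ 0) : toCP v ∈ hyperplane f ↔ f v = 0 := by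
  rw [hyperplane_eq_projSubspace, toCP_mem_projSubspace hv, LinearMap.mem_ker]

/-- The common zeros in `ℂ^(n+1)` of the forms in `B`. -/
def flat (l : Fin r → Module.Dual ℂ (Fin (n + 1) → ℂ)) (B : Finset (Fin r)) :
    Submodule ℂ (Fin (n + 1) → ℂ) :=
  (Submodule.span ℂ (Set.range fun i : B => l i)).dualCoannihilator

theorem mem_flat {B : Finset (Fin r)} {v : Fin (n + 1) → ℂ} :
    v ∈ flat l B ↔ ∀ i ∈ B, l i v = 0 := by
  rw [flat, Submodule.mem_dualCoannihilator]
  refine ⟨fun h i hi => h _ (Submodule.subset_span ⟨⟨i, hi⟩, rfl⟩), fun h f hf => ?_⟩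
  induction hf using Submodule.span_induction with
  | mem x hx => obtain ⟨i, rfl⟩ := hx; exact h i i.2
  | zero => rfl
  | add x y _ _ hx hy => rw [LinearMap.add_apply, hx, hy, add_zero]
  | smul a x _ hx => rw [LinearMap.smul_apply, hx, smul_zero]

theorem InGeneralPosition.finrank_flat (hl : InGeneralPosition l) {B : Finset (Fin r)}
    (hB : B.card ≤ n + 1) : Module.finrank ℂ (flat l B) = n + 1 - B.card := by
  have h₁ := Subspace.finrank_add_finrank_dualCoannihilator_eq
    (Submodule.span ℂ (Set.range fun i : B => l i))
  rw [finrank_span_eq_card (hl B hB), Fintype.card_coe, Module.finrank_fin_fun] at h₁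
  rw [flat]
  omega

/-- The points that lie on precisely the hyperplanes in `B`. -/
def openStratum (l : Fin r → Module.Dual ℂ (Fin (n + 1) → ℂ)) (B : Finset (Fin r)) : Set (CP n) :=
  {p | ∀ i, p ∈ hyperplane (l i) ↔ i ∈ B}

/-- At most `n` of the hyperplanes have a common point that lies on no further hyperplane, since a
vector space is not a finite union of proper subspaces. -/
theorem InGeneralPosition.nonempty_openStratum (hl : InGeneralPosition l) {B : Finset (Fin r)}
    (hB : B.card ≤ n) : (openStratum l B).Nonempty := by
  classical
  have hW : flat l B ≠ ⊥ := fun h => by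
    have := hl.finrank_flat (B := B) (by omega)
    rw [h, finrank_bot] at this
    omega
  have : Nontrivial (flat l B) := Submodule.nontrivial_iff_ne_bot.2 hW
  set P : Finset (Submodule ℂ (flat l B)) :=
    insert ⊥ (Bᶜ.image fun j => LinearMap.ker (l j ∘ₗ (flat l B).subtype))
  have hP : ⊤ ∉ P := by
    simp only [P, Finset.mem_insert, Finset.mem_image, not_or, not_exists, not_and]
    refine ⟨top_ne_bot, fun j hj h => ?_⟩
    obtain ⟨v, hv⟩ := exists_forall_apply_eq (hl (insert j B) (by
      exact (Finset.card_insert_le _ _).trans (by omega))) fun i => if i = j then 1 else 0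
    have hjB : j ∉ B := Finset.mem_compl.1 hj
    have hvB : v ∈ flat l B := mem_flat.2 fun i hi => by
      rw [hv i (Finset.mem_insert_of_mem hi), if_neg (ne_of_mem_of_not_mem hi hjB)]
    have h0 : (⟨v, hvB⟩ : flat l B) ∈ LinearMap.ker (l j ∘ₗ (flat l B).subtype) :=
      h ▸ Submodule.mem_top
    have h1 := hv j (Finset.mem_insert_self _ _)
    rw [if_pos rfl] at h1
    exact one_ne_zero (h1.symm.trans h0)
  obtain ⟨v, hv⟩ := (Set.ne_univ_iff_exists_notMem _).1
    (Subspace.biUnion_ne_univ_of_top_notMem hP)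
  simp only [Set.mem_iUnion, not_exists] at hv
  have hv0 : (v : Fin (n + 1) → ℂ) ≠ 0 := fun h =>
    hv ⊥ (Finset.mem_insert_self _ _) (Submodule.coe_eq_zero.1 h)
  refine ⟨toCP v, fun i => ?_⟩
  rw [toCP_mem_hyperplane hv0]
  refine ⟨fun h => ?_, fun h => mem_flat.1 v.2 i h⟩
  by_contra hi
  exact hv _ (Finset.mem_insert_of_mem
    (Finset.mem_image.2 ⟨i, Finset.mem_compl.2 hi, rfl⟩)) h

theorem InGeneralPosition.nonempty_iInter_iff (hl : InGeneralPosition l) {B : Finset (Fin r)} :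
    (⋂ i ∈ B, hyperplane (l i)).Nonempty ↔ B.card ≤ n := by
  constructor
  · rintro ⟨p, hp⟩
    by_contra h
    refine p.rep_nonzero (hl.eq_zero (T := B) (by omega) fun i hi => ?_)
    have := Set.mem_iInter₂.1 hp i hi
    rwa [hyperplane_eq_projSubspace] at this
  · intro h
    obtain ⟨p, hp⟩ := hl.nonempty_openStratum h
    exact ⟨p, Set.mem_iInter₂.2 fun i hi => (hp i).2 hi⟩

theorem InGeneralPosition.stratum_iInter (hl : InGeneralPosition l) {B : Finset (Fin r)}
    (hB : B.card ≤ n) : stratum l (⋂ i ∈ B, hyperplane (l i)) = openStratum l B := by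
  obtain ⟨q, hq⟩ := hl.nonempty_openStratum hB
  ext p
  constructor
  · rintro ⟨hp, hp'⟩ i
    exact ⟨fun h => (hq i).1 (hp' i h (Set.mem_iInter₂.2 fun i hi => (hq i).2 hi)),
      fun h => Set.mem_iInter₂.1 hp i h⟩
  · exact fun hp => ⟨Set.mem_iInter₂.2 fun i hi => (hp i).2 hi, fun i hi =>
      Set.biInter_subset_of_mem ((hp i).1 hi)⟩

open Classical in
theorem InGeneralPosition.stratification_eq (hl : InGeneralPosition l) :
    stratification l = (Finset.univ.filter fun B : Finset (Fin r) => B.card ≤ n).image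
      (openStratum l) := by
  rw [stratification, intersectionLattice, Finset.filter_image, Finset.image_image]
  simp only [hl.nonempty_iInter_iff]
  refine Finset.image_congr fun B hB => ?_
  exact hl.stratum_iInter (by simpa using hB)

theorem InGeneralPosition.injOn_openStratum (hl : InGeneralPosition l) :
    Set.InjOn (openStratum l) {B | B.card ≤ n} := by
  intro B hB B' _ h
  obtain ⟨p, hp⟩ := hl.nonempty_openStratum hB
  have hp' : p ∈ openStratum l B' := h ▸ hp
  ext i
  rw [← hp i, hp' i]

theorem InGeneralPosition.valueOn_openStratum (hl : InGeneralPosition l) (m : Fin r → ℕ)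
    {B : Finset (Fin r)} (hB : B.card ≤ n) :
    valueOn (bFunction l m) (openStratum l B) = ∏ i ∈ B, m i := by
  classical
  refine valueOn_eq (hl.nonempty_openStratum hB) fun p hp => ?_
  rw [bFunction]
  congr 1
  ext i
  rw [Finset.mem_filter_univ, hp i]

/-- The Euler number of the complement of `s` hyperplanes in general position in projective space
of dimension `d - 1`, which is empty for `d = 0`. -/
def projEuler (d s : ℕ) : ℤ := ∑ j ∈ Finset.range d, (-1) ^ j * (s.choose j : ℤ) * (d - j : ℕ)

theorem projEuler_succ (d s : ℕ) :
    projEuler (d + 1) s = projEuler d s + affineEuler (d + 1) s := by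
  have : projEuler d s =
      ∑ j ∈ Finset.range (d + 1), (-1) ^ j * (s.choose j : ℤ) * (d - j : ℕ) := by
    rw [Finset.sum_range_succ, Nat.sub_self, Nat.cast_zero, mul_zero, add_zero, projEuler]
  rw [this, affineEuler, projEuler, ← Finset.sum_add_distrib]
  refine Finset.sum_congr rfl fun j hj => ?_
  rw [Nat.succ_sub (Finset.mem_range_succ_iff.1 hj)]
  push_cast
  ring

/-- One of the hyperplanes can serve as hyperplane at infinity. -/
theorem projEuler_succ_right (d s : ℕ) : projEuler d (s + 1) = affineEuler d s := by
  induction d with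
  | zero => simp [projEuler, affineEuler]
  | succ d ih => rw [projEuler_succ, ih, affineEuler_succ_succ]; ring

theorem projEuler_zero_right (d : ℕ) : projEuler d 0 = d := by
  induction d with
  | zero => simp [projEuler]
  | succ d ih => rw [projEuler_succ, ih]; simp [affineEuler, Finset.sum_range_succ']

theorem InGeneralPosition.hasEuler_openStratum (hl : InGeneralPosition l) {B : Finset (Fin r)}
    (hB : B.card ≤ n) : HasEuler (openStratum l B) (projEuler (n + 1 - B.card) (r - B.card)) := by
  by_cases h : ∃ i₀, i₀ ∉ B
  · obtain ⟨i₀, hi₀⟩ := h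
    set I : Finset (Fin r) := (insert i₀ B)ᶜ
    have hc : r - B.card = I.card + 1 := by
      have h₁ := Finset.card_compl (insert i₀ B)
      have h₂ := Finset.card_le_univ (insert i₀ B)
      rw [Finset.card_insert_of_notMem hi₀, Fintype.card_fin] at h₁ h₂
      simp only [I]
      omega
    rw [hc, projEuler_succ_right]
    refine (hasEuler_affineStratum hl hi₀ (by simp [I]) ?_ (by omega)).of_homeomorph
      (chartHomeomorph (l i₀) _ (affineStratum l i₀ B I) (fun v hv => hv.1.1) fun v hv => ?_).symm
    · exact disjoint_compl_right.mono_left (Finset.subset_insert _ _)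
    · simp only [openStratum, Set.mem_ofPred_eq, toCP_mem_hyperplane hv]
      constructor
      · intro h
        have h0 : l i₀ v ≠ 0 := fun h' => hi₀ ((h i₀).1 h')
        refine ⟨h0, ⟨by simp [h0], fun i hi => by simp [(h i).2 hi]⟩, fun i hi => ?_⟩
        have hiB : i ∉ B := fun h' => Finset.mem_compl.1 hi (Finset.mem_insert_of_mem h')
        simpa [h0] using fun h' => hiB ((h i).1 h')
      · rintro ⟨h0, ⟨-, h1⟩, h2⟩ i
        refine ⟨fun h => ?_, fun hi => by simpa [h0] using h1 i hi⟩
        by_contra hi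
        have hii : i ≠ i₀ := fun h' => h0 (h' ▸ h)
        exact h2 i (by simp [I, hi, hii]) (by simp [h])
  · push Not at h
    obtain rfl : B = Finset.univ := Finset.eq_univ_iff_forall.2 h
    have hr : (Finset.univ : Finset (Fin r)).card = r := Finset.card_fin r
    have := hasEuler_projSubspace (flat l Finset.univ)
    rw [hl.finrank_flat (by omega)] at this
    rw [hr, Nat.sub_self, projEuler_zero_right]
    rw [hr] at this
    refine this.of_eq ?_
    ext p
    rw [projSubspace, Set.mem_ofPred_eq, mem_flat, openStratum, Set.mem_ofPred_eq]
    simp [hyperplane_eq_projSubspace, projSubspace]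

end Strata

/-! ### Summation over the strata -/

section Combinatorics

variable {r : ℕ}

/-- Inclusion-exclusion over the flats defined by the sets `B ∪ C`, which have Euler number
`n + 1 - |B ∪ C|`. Truncated subtraction accounts for the empty flats. -/
theorem projEuler_eq_sum (n : ℕ) (B : Finset (Fin r)) :
    projEuler (n + 1 - B.card) (r - B.card) =
      ∑ C ∈ Bᶜ.powerset, (-1) ^ C.card * ((n + 1 - (B.card + C.card) : ℕ) : ℤ) := by
  rw [Finset.sum_powerset_apply_card fun j => (-1) ^ j * ((n + 1 - (B.card + j) : ℕ) : ℤ),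
    Finset.card_compl, Fintype.card_fin, projEuler]
  set d := n + 1 - B.card with hd
  set s := r - B.card
  have h : ∀ j, (-1) ^ j * (s.choose j : ℤ) * (d - j : ℕ) =
      s.choose j • ((-1) ^ j * ((n + 1 - (B.card + j) : ℕ) : ℤ)) := fun j => by
    rw [nsmul_eq_mul, hd, Nat.sub_sub]
    ring
  rw [Finset.sum_congr rfl fun j _ => h j]
  -- both sums may be extended by vanishing terms
  trans ∑ j ∈ Finset.range (max d (s + 1)),
    s.choose j • ((-1) ^ j * ((n + 1 - (B.card + j) : ℕ) : ℤ))
  · refine Finset.sum_subset (Finset.range_mono (le_max_left _ _)) fun j _ hj => ?_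
    rw [Finset.mem_range, not_lt] at hj
    rw [show n + 1 - (B.card + j) = 0 by omega]
    simp
  · refine (Finset.sum_subset (Finset.range_mono (le_max_right _ _)) fun j _ hj => ?_).symm
    rw [Finset.mem_range, not_lt] at hj
    rw [Nat.choose_eq_zero_of_lt (by omega), zero_smul]

theorem sum_projEuler_mul_prod (n : ℕ) (x : Fin r → ℚ) :
    ∑ B : Finset (Fin r), (projEuler (n + 1 - B.card) (r - B.card) : ℚ) * ∏ i ∈ B, x i =
      ∑ B : Finset (Fin r), ((n + 1 - B.card : ℕ) : ℚ) * ∏ i ∈ B, (x i - 1) := by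
  have h : ∀ B : Finset (Fin r), ((n + 1 - B.card : ℕ) : ℚ) * ∏ i ∈ B, (x i - 1) =
      ∑ A ∈ B.powerset, ((n + 1 - B.card : ℕ) : ℚ) * ((-1) ^ (B \ A).card * ∏ i ∈ A, x i) := by
    intro B
    simp_rw [sub_eq_add_neg, Finset.prod_add, Finset.mul_sum, Finset.prod_const]
    refine Finset.sum_congr rfl fun A _ => by ring
  simp_rw [h]
  -- exchange the sums over `B` and over `A ⊆ B`, and write `B = A ∪ C`
  rw [Finset.sum_comm' (s' := fun A => Finset.univ.filter (A ⊆ ·)) (t' := Finset.univ)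
    (by simp)]
  refine Finset.sum_congr rfl fun A _ => ?_
  rw [projEuler_eq_sum]
  push_cast
  rw [Finset.sum_mul]
  refine Finset.sum_nbij' (fun C => A ∪ C) (fun B => B \ A) ?_ ?_ ?_ ?_ ?_
  · intro C _
    simp
  · intro B _
    simp [Finset.subset_iff]
  · intro C hC
    have := Finset.subset_compl_iff_disjoint_right.1 (Finset.mem_powerset.1 hC)
    exact this.symm.sup_sdiff_cancel_left
  · intro B hB
    exact Finset.union_sdiff_of_subset (Finset.mem_filter.1 hB).2
  · intro C hC
    have := Finset.subset_compl_iff_disjoint_right.1 (Finset.mem_powerset.1 hC)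
    rw [Finset.card_union_of_disjoint this.symm,
      show (A ∪ C) \ A = C from this.symm.sup_sdiff_cancel_left]
    ring

end Combinatorics

end LinearOrbifold

end

theorem mainTheorem3 (n r : ℕ) (l : Fin r → Module.Dual ℂ (Fin (n + 1) → ℂ))
    (hl : LinearOrbifold.InGeneralPosition l) (m : Fin r → ℕ) (hm : ∀ i, 1 ≤ m i) :
    (∀ S ∈ LinearOrbifold.stratification l, LinearOrbifold.HasFiniteHomology S) ∧
    LinearOrbifold.orbifoldEulerNumber (LinearOrbifold.stratification l)
        (LinearOrbifold.bFunction l m) =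
      ∑ j ∈ Finset.range (n + 1), (-1 : ℚ) ^ j * ((n : ℚ) + 1 - (j : ℚ)) *
        ∑ B ∈ Finset.powersetCard j (Finset.univ : Finset (Fin r)),
          ∏ i ∈ B, (1 - 1 / (m i : ℚ)) := by
  rw [hl.stratification_eq]
  constructor
  · intro S hS
    obtain ⟨B, hB, rfl⟩ := Finset.mem_image.1 hS
    exact (hl.hasEuler_openStratum (by simpa using hB)).hasFiniteHomology
  rw [LinearOrbifold.orbifoldEulerNumber, Finset.sum_image fun B hB B' hB' h =>
    hl.injOn_openStratum (by simpa using hB) (by simpa using hB') h]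
  -- sets of more than `n` hyperplanes may be included, as they contribute zero
  have h : ∀ B : Finset (Fin r), B ∉ Finset.univ.filter (fun B : Finset (Fin r) => B.card ≤ n) →
      n + 1 - B.card = 0 := fun B hB => by
    rw [Finset.mem_filter_univ] at hB
    omega
  calc
    _ = ∑ B with B.card ≤ n, (LinearOrbifold.projEuler (n + 1 - B.card) (r - B.card) : ℚ) *
          ∏ i ∈ B, 1 / (m i : ℚ) := by
      refine Finset.sum_congr rfl fun B hB => ?_
      have hB' : B.card ≤ n := by simpa using hB
      rw [(hl.hasEuler_openStratum hB').eulerNumber_eq, hl.valueOn_openStratum m hB',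
        div_eq_mul_inv]
      simp
    _ = ∑ B : Finset (Fin r), (LinearOrbifold.projEuler (n + 1 - B.card) (r - B.card) : ℚ) *
          ∏ i ∈ B, 1 / (m i : ℚ) :=
      Finset.sum_subset (Finset.filter_subset _ _) fun B _ hB => by
        simp [h B hB, LinearOrbifold.projEuler]
    _ = ∑ B : Finset (Fin r), ((n + 1 - B.card : ℕ) : ℚ) * ∏ i ∈ B, (1 / (m i : ℚ) - 1) :=
      LinearOrbifold.sum_projEuler_mul_prod n _
    _ = ∑ B with B.card ≤ n, ((n + 1 - B.card : ℕ) : ℚ) * ∏ i ∈ B, (1 / (m i : ℚ) - 1) :=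
      (Finset.sum_subset (Finset.filter_subset _ _) fun B _ hB => by simp [h B hB]).symm
    _ = ∑ j ∈ Finset.range (n + 1), ∑ B with B.card ≤ n ∧ B.card = j,
          ((n + 1 - B.card : ℕ) : ℚ) * ∏ i ∈ B, (1 / (m i : ℚ) - 1) := by
      simp_rw [← Finset.filter_filter]
      exact (Finset.sum_fiberwise_of_maps_to (fun B hB => by
        rw [Finset.mem_filter_univ] at hB
        rw [Finset.mem_range]
        omega) _).symm
    _ = _ := by
      refine Finset.sum_congr rfl fun j hj => ?_
      rw [Finset.mul_sum]
      refine Finset.sum_congr ?_ fun B hB => ?_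
      · ext B
        rw [Finset.mem_filter_univ, Finset.mem_powersetCard]
        rw [Finset.mem_range] at hj
        exact ⟨fun h => ⟨Finset.subset_univ _, h.2⟩, fun h => ⟨by omega, h.2⟩⟩
      · obtain ⟨-, rfl⟩ := Finset.mem_powersetCard.1 hB
        rw [Nat.cast_sub (Finset.mem_range.1 hj).le, mul_right_comm, ← Finset.prod_const,
          ← Finset.prod_mul_distrib, mul_comm]
        push_cast
        congr 1
        exact Finset.prod_congr rfl fun i _ => by ring
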